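/- Let $d\ge 3$ be an integer and let $p\ge 1$ be a real number. There is a finite constant $f_\infty^{\mathrm{bi}}=f_\infty^{\mathrm{bi}}(p,d)>0$, depending only on $p$ and $d$, with the following property. Let $(X_i)_{i\ge 1}$ and $(Y_i)_{i\ge 1}$ be two independent families of i.i.d. random variables, each uniformly distributed (with respect to Lebesgue measure) on the unit cube $[0,1]^d$. Then $$\lim_{n\to\infty} n^{p/d}\,\mathbb{E}\left[\frac1n\min_{\pi}\sum_{i=1}^n |X_i-Y_{\pi(i)}|^p\right]=f_\infty^{\mathrm{bi}},$$ where the minimum is over all permutations $\pi$ of $\{1,\dots,n\}$ and $|\cdot|$ is the Euclidean norm on $\mathbb{R}^d$; the random variables inside the expectation are integrable. -/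

import Mathlib

open MeasureTheory ProbabilityTheory Filter Topology

/-- The unit cube `[0,1]^d` in Euclidean space `ℝ^d`. -/
def unitCube (d : ℕ) : Set (EuclideanSpace ℝ (Fin d)) :=
  {x | ∀ i, x i ∈ Set.Icc (0 : ℝ) 1}

/-- The minimal bipartite matching cost of two families of `n` points, with cost `|x - y| ^ p`
for the Euclidean norm: the minimum over all permutations `π` of `∑ i, |x i - y (π i)| ^ p`. -/
noncomputable def minMatchingCost {d n : ℕ} (p : ℝ)
    (x y : Fin n → EuclideanSpace ℝ (Fin d)) : ℝ :=
  (Finset.univ : Finset (Equiv.Perm (Fin n))).inf' Finset.univ_nonempty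
    fun π => ∑ i, ‖x i - y (π i)‖ ^ p

/-! Let c(a, n) be the p-mean matching distance (E[cost]/n)^(1/p) of n + n uniform points in a box
with side lengths a (`normCost`). Cut the box across a coordinate by rank rather than by position:
the n₁ lowest points of X are matched with the n₁ lowest points of Y, the remaining n₂ with the
remaining n₂. Given the next point above it, a lower block is i.i.d. uniform in a box whose relative
length is Beta distributed and fluctuates by order n^(-1/2) around n₁/n, where n = n₁ + n₂. Moving
both blocks to that deterministic length costs C·a_i·n^(-1/2) by Minkowski, so n·c(a, n)^p is at
most the sum of n_k·(c(child k) + C·a_i·n^(-1/2))^p over the two children (`expCost_le_blockCost`,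
`blockCost_rpow_le`). Both children keep deterministic counts and the point density of the parent,
so X and Y never have unequal numbers of points. `IsSplitCost` abstracts this inequality; the limit
is derived from it alone.

In a box of bounded aspect ratio with volume λ^d per point, the sides are of order n^(1/d)·λ and the
correction is of order λ·n^(-(1/2 - 1/d)). For d ≥ 3 the exponent is positive, so along a tree of
near-halvings the corrections form a geometric series dominated by the smallest boxes
(`le_of_tree`). Stopping at single points bounds the normalized cost n^(1/d)·c(1, n). Stopping at
unit cubes with m points bounds the normalized cost at m·k^d points by the one at m, up to
O(m^(-(1/2 - 1/d))) (`cube_le`).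

For general n, a slab with a proportion of points between δ and 2δ is cut off so that exactly m·k^d
points remain (`normalized_rpow_le`). Letting n → ∞ and then δ → 0 bounds the limsup by the value at
m plus the small error; taking m along a sequence realizing the liminf gives convergence. The limit
is positive because balls of radius of order n^(-1/d) around the X points cover at most half of the
cube (`le_expCost`). -/

open scoped ENNReal

/-! ### Split costs and balanced boxes -/

/-- Cost functionals `c a n` of boxes with side lengths `a` and `n` points that are compatible with
cutting a box orthogonally to a coordinate direction, proportionally to the number of points. -/
structure IsSplitCost {d : ℕ} (p C D : ℝ) (c : (Fin d → ℝ) → ℕ → ℝ) : Prop where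
  one_le : 1 ≤ p
  const_nonneg : 0 ≤ C
  diam_nonneg : 0 ≤ D
  nonneg : ∀ a n, 0 ≤ c a n
  mono : ∀ a b n, (∀ i, 0 ≤ a i) → (∀ i, a i ≤ b i) → c a n ≤ c b n
  smul : ∀ (t : ℝ) a n, 0 < t → c (t • a) n = t * c a n
  diam : ∀ a n (K : ℝ), (∀ i, 0 ≤ a i) → (∀ i, a i ≤ K) → c a n ≤ D * K
  split : ∀ a (n₁ n₂ : ℕ) (i : Fin d), (∀ j, 0 < a j) → 1 ≤ n₁ → 1 ≤ n₂ →
    ((n₁ + n₂ : ℕ) : ℝ) * c a (n₁ + n₂) ^ p ≤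
      n₁ * (c (Function.update a i (a i * ((n₁ : ℝ) / (n₁ + n₂ : ℕ)))) n₁ +
        C * a i * ((n₁ + n₂ : ℕ) : ℝ) ^ (-(1 / 2) : ℝ)) ^ p +
      n₂ * (c (Function.update a i (a i * ((n₂ : ℝ) / (n₁ + n₂ : ℕ)))) n₂ +
        C * a i * ((n₁ + n₂ : ℕ) : ℝ) ^ (-(1 / 2) : ℝ)) ^ p

/-- The exponent `1 / 2 - 1 / d` governing the size of the boundary corrections. -/
noncomputable def gapExp (d : ℕ) : ℝ := 1 / 2 - 1 / d

theorem gapExp_pos {d : ℕ} (hd : 3 ≤ d) : 0 < gapExp d := by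
  have h3 : (3 : ℝ) ≤ d := by exact_mod_cast hd
  have : 1 / (d : ℝ) ≤ 1 / 3 := one_div_le_one_div_of_le (by norm_num) h3
  unfold gapExp; linarith

/-- All sides are at least a_i / 3, so (a_i / 3)^d is at most the volume. -/
theorem le_three_mul_of_prod_eq {d : ℕ} (hd : d ≠ 0) {a : Fin d → ℝ} {lam N : ℝ} (hlam : 0 < lam)
    (hN : 0 ≤ N) (hpos : ∀ i, 0 < a i) (hbal : ∀ i j, a i ≤ 3 * a j)
    (hvol : ∏ i, a i = N * lam ^ d) (i : Fin d) : a i ≤ 3 * (N ^ (1 / (d : ℝ)) * lam) := by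
  have h1 : (a i / 3) ^ d ≤ (N ^ (1 / (d : ℝ)) * lam) ^ d := by
    calc (a i / 3) ^ d = ∏ _j : Fin d, a i / 3 := by simp [div_pow]
      _ ≤ ∏ j, a j := Finset.prod_le_prod (fun j _ => by have := hpos i; positivity)
          (fun j _ => by have := hbal i j; linarith)
      _ = _ := by
        rw [hvol, mul_pow, ← Real.rpow_natCast (N ^ (1 / (d : ℝ))), ← Real.rpow_mul hN,
          one_div_mul_cancel (by exact_mod_cast hd), Real.rpow_one]
  have h2 := le_of_pow_le_pow_left₀ hd (by positivity) h1
  linarith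

theorem prod_update_mul {d : ℕ} (a : Fin d → ℝ) (i : Fin d) (s : ℝ) :
    ∏ j, Function.update a i (a i * s) j = (∏ j, a j) * s := by
  rw [Finset.prod_update_of_mem (Finset.mem_univ i),
    ← Finset.mul_prod_erase Finset.univ a (Finset.mem_univ i), Finset.erase_eq]
  ring

/-- Only the longest side shrinks, and at worst to a third of itself: every other side is still at
most three times the new one. -/
theorem balanced_update {d : ℕ} {a : Fin d → ℝ} {i : Fin d} {s : ℝ} (hpos : ∀ j, 0 < a j)
    (hbal : ∀ j k, a j ≤ 3 * a k) (hi : ∀ j, a j ≤ a i) (hs : 1 / 3 ≤ s) (hs1 : s ≤ 1) (j k : Fin d) :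
    Function.update a i (a i * s) j ≤ 3 * Function.update a i (a i * s) k := by
  have hi0 := hpos i
  rcases eq_or_ne j i with rfl | hj <;> rcases eq_or_ne k j with rfl | hk
  · simp; nlinarith
  · simp [Function.update_of_ne hk]
    have := hbal j k
    nlinarith
  · have := hpos k
    simp [Function.update_of_ne hj]; linarith
  · rw [Function.update_of_ne hj]
    rcases eq_or_ne k i with rfl | hk'
    · simp; have := hi j; nlinarith
    · rw [Function.update_of_ne hk']; exact hbal j k

theorem update_pos {d : ℕ} {a : Fin d → ℝ} {i : Fin d} {s : ℝ} (hpos : ∀ j, 0 < a j) (hs : 0 < s)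
    (j : Fin d) : 0 < Function.update a i (a i * s) j := by
  rcases eq_or_ne j i with rfl | hj
  · simpa using mul_pos (hpos j) hs
  · simpa [Function.update_of_ne hj] using hpos j

/-- The extreme ratios 1/3 and 2/3 occur at n = 3; this is why aspect ratio 3 is the notion of
balance used throughout. -/
theorem half_ratio {n : ℕ} (hn : 2 ≤ n) {k : ℕ} (hk : k = n / 2 ∨ k = n - n / 2) :
    1 / 3 ≤ (k : ℝ) / n ∧ (k : ℝ) / n ≤ 2 / 3 ∧ 1 ≤ k := by
  have hn0 : (0 : ℝ) < n := by positivity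
  have h1 : n ≤ 3 * k ∧ 3 * k ≤ 2 * n ∧ 1 ≤ k := by omega
  have h2 : (n : ℝ) ≤ 3 * k := by exact_mod_cast h1.1
  have h3 : (3 : ℝ) * k ≤ 2 * n := by exact_mod_cast h1.2.1
  refine ⟨?_, ?_, h1.2.2⟩
  · rw [le_div_iff₀ hn0]; linarith
  · rw [div_le_iff₀ hn0]; linarith

/-! ### Accumulated corrections along splitting trees -/

namespace IsSplitCost

variable {d : ℕ} {p C D : ℝ} {c : (Fin d → ℝ) → ℕ → ℝ}

/-- The weights n₁/n and n₂/n add up to 1, so the p-mean of the two children is at most their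
maximum. Passing to the maximum makes the corrections add along a branch. -/
theorem le_of_children (h : IsSplitCost p C D c) {a : Fin d → ℝ} {n₁ n₂ : ℕ} {i : Fin d}
    (hpos : ∀ j, 0 < a j) (h₁ : 1 ≤ n₁) (h₂ : 1 ≤ n₂) {T : ℝ}
    (hT₁ : c (Function.update a i (a i * ((n₁ : ℝ) / (n₁ + n₂ : ℕ)))) n₁ +
        C * a i * ((n₁ + n₂ : ℕ) : ℝ) ^ (-(1 / 2) : ℝ) ≤ T)
    (hT₂ : c (Function.update a i (a i * ((n₂ : ℝ) / (n₁ + n₂ : ℕ)))) n₂ +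
        C * a i * ((n₁ + n₂ : ℕ) : ℝ) ^ (-(1 / 2) : ℝ) ≤ T) :
    c a (n₁ + n₂) ≤ T := by
  have hp : 0 < p := by linarith [h.one_le]
  have hn : (0 : ℝ) < (n₁ + n₂ : ℕ) := by positivity
  have he : 0 ≤ C * a i * ((n₁ + n₂ : ℕ) : ℝ) ^ (-(1 / 2) : ℝ) := by
    have := h.const_nonneg; have := hpos i; positivity
  have hT : 0 ≤ T := le_trans (add_nonneg (h.nonneg _ _) he) hT₁
  have e1 := Real.rpow_le_rpow (add_nonneg (h.nonneg _ _) he) hT₁ hp.le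
  have e2 := Real.rpow_le_rpow (add_nonneg (h.nonneg _ _) he) hT₂ hp.le
  have := h.split a n₁ n₂ i hpos h₁ h₂
  have key : ((n₁ + n₂ : ℕ) : ℝ) * c a (n₁ + n₂) ^ p ≤ ((n₁ + n₂ : ℕ) : ℝ) * T ^ p := by
    refine this.trans ?_
    calc _ ≤ (n₁ : ℝ) * T ^ p + n₂ * T ^ p := by gcongr
      _ = _ := by push_cast; ring
  exact (Real.rpow_le_rpow_iff (h.nonneg _ _) hT hp).1 (le_of_mul_le_mul_left key hn)

/-- The constant bounding the accumulated corrections along a balanced splitting tree. -/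
noncomputable def treeConst (d : ℕ) (C : ℝ) : ℝ := 3 * C / ((3 / 2 : ℝ) ^ gapExp d - 1)

theorem one_lt_rpow_gapExp (hd : 3 ≤ d) : 1 < (3 / 2 : ℝ) ^ gapExp d :=
  Real.one_lt_rpow (by norm_num) (gapExp_pos hd)

theorem treeConst_nonneg (h : IsSplitCost p C D c) (hd : 3 ≤ d) : 0 ≤ treeConst d C :=
  div_nonneg (by linarith [h.const_nonneg]) (by linarith [one_lt_rpow_gapExp hd])

/-- If a box can be recursively split into balanced boxes until a cost bounded by `A` is reached,
then its cost exceeds `A` by a boundary correction only. -/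
theorem le_of_tree (h : IsSplitCost p C D c) (hd : 3 ≤ d) {lam A : ℝ} (hlam : 0 < lam) {m : ℕ}
    (hm : 1 ≤ m) (R : (Fin d → ℝ) → ℕ → Prop)
    (hpos : ∀ a n, R a n → ∀ i, 0 < a i) (hbal : ∀ a n, R a n → ∀ i j, a i ≤ 3 * a j)
    (hvol : ∀ a n, R a n → ∏ i, a i = n * lam ^ d) (hge : ∀ a n, R a n → m ≤ n)
    (hsplit : ∀ a n, R a n → (c a n ≤ A ∧ m ≤ n) ∨ ∃ n₁ n₂ : ℕ, ∃ i : Fin d, n = n₁ + n₂ ∧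
      (n₁ : ℝ) ≤ 2 / 3 * n ∧ (n₂ : ℝ) ≤ 2 / 3 * n ∧
      R (Function.update a i (a i * ((n₁ : ℝ) / n))) n₁ ∧
      R (Function.update a i (a i * ((n₂ : ℝ) / n))) n₂) :
    ∀ n a, R a n →
      c a n ≤ A + treeConst d C * lam * ((m : ℝ) ^ (-gapExp d) - (n : ℝ) ^ (-gapExp d)) := by
  have hγ := gapExp_pos hd
  have hB := h.treeConst_nonneg hd
  have hC := h.const_nonneg
  intro n
  induction n using Nat.strong_induction_on with
  | _ n ih =>
  intro a ha
  have hm0 : (0 : ℝ) < m := by positivity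
  have hmn := hge a n ha
  have hn0 : (0 : ℝ) < n := lt_of_lt_of_le hm0 (by exact_mod_cast hmn)
  rcases hsplit a n ha with hA | ⟨n₁, n₂, i, hn, h1, h2, R1, R2⟩
  -- At a leaf the correction term is merely nonnegative, since m ≤ n.
  · have : (n : ℝ) ^ (-gapExp d) ≤ (m : ℝ) ^ (-gapExp d) :=
      Real.rpow_le_rpow_of_nonpos hm0 (by exact_mod_cast hmn) (by linarith)
    have := mul_nonneg (mul_nonneg hB hlam.le) (sub_nonneg.2 this)
    linarith [hA.1]
  · have key : ∀ k : ℕ, 1 ≤ k → (k : ℝ) ≤ 2 / 3 * n →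
        R (Function.update a i (a i * ((k : ℝ) / n))) k →
        c (Function.update a i (a i * ((k : ℝ) / n))) k + C * a i * (n : ℝ) ^ (-(1 / 2) : ℝ) ≤
          A + treeConst d C * lam * ((m : ℝ) ^ (-gapExp d) - (n : ℝ) ^ (-gapExp d)) := by
      intro k hk1 hk hR
      have hk0 : (0 : ℝ) < k := by positivity
      have hlt : k < n := by
        have : (k : ℝ) < n := by linarith
        exact_mod_cast this
      have e1 := ih k hlt _ hR
      -- Balance and the fixed density turn the side into n^(1/d)·λ; multiplied by n^(-1/2) it
      -- leaves the exponent -`gapExp d`.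
      have e2 : C * a i * (n : ℝ) ^ (-(1 / 2) : ℝ) ≤ 3 * C * lam * (n : ℝ) ^ (-gapExp d) := by
        have := le_three_mul_of_prod_eq (by omega) hlam hn0.le (hpos a n ha) (hbal a n ha)
          (hvol a n ha) i
        have e : (n : ℝ) ^ (-gapExp d) = (n : ℝ) ^ (1 / (d : ℝ)) * (n : ℝ) ^ (-(1 / 2) : ℝ) := by
          rw [← Real.rpow_add hn0]; congr 1; unfold gapExp; ring
        rw [e]
        calc C * a i * (n : ℝ) ^ (-(1 / 2) : ℝ)
            ≤ C * (3 * ((n : ℝ) ^ (1 / (d : ℝ)) * lam)) * (n : ℝ) ^ (-(1 / 2) : ℝ) := by gcongr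
          _ = _ := by ring
      have e3 : (3 / 2 : ℝ) ^ gapExp d * (n : ℝ) ^ (-gapExp d) ≤ (k : ℝ) ^ (-gapExp d) := by
        have : (3 / 2 : ℝ) ^ gapExp d * (n : ℝ) ^ (-gapExp d) = (2 / 3 * n : ℝ) ^ (-gapExp d) := by
          rw [Real.mul_rpow (by norm_num) hn0.le, Real.rpow_neg (by norm_num : (0 : ℝ) ≤ 2 / 3),
            ← Real.inv_rpow (by norm_num)]
          norm_num
        rw [this]
        exact Real.rpow_le_rpow_of_nonpos hk0 hk (by linarith)
      have e4 : 3 * C * lam * (n : ℝ) ^ (-gapExp d) =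
          treeConst d C * lam * (((3 / 2 : ℝ) ^ gapExp d - 1) * (n : ℝ) ^ (-gapExp d)) := by
        have := one_lt_rpow_gapExp hd
        have h0 : (3 / 2 : ℝ) ^ gapExp d - 1 ≠ 0 := by linarith
        unfold treeConst; field_simp
      -- A child has k ≤ 2n/3 points, so the increment from n^(-γ) to k^(-γ) pays for the correction
      -- at this node and the bound telescopes. `treeConst` is chosen for exactly this.
      have e5 : treeConst d C * lam * (((3 / 2 : ℝ) ^ gapExp d - 1) * (n : ℝ) ^ (-gapExp d)) ≤
          treeConst d C * lam * ((k : ℝ) ^ (-gapExp d) - (n : ℝ) ^ (-gapExp d)) :=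
        mul_le_mul_of_nonneg_left (by linarith) (mul_nonneg hB hlam.le)
      linarith
    have g1 := hge _ _ R1
    have g2 := hge _ _ R2
    have k1 := key n₁ (by omega) h1 R1
    have k2 := key n₂ (by omega) h2 R2
    subst hn
    exact h.le_of_children (hpos a _ ha) (by omega) (by omega) k1 k2

theorem exists_split_max (hd : 3 ≤ d) (a : Fin d → ℝ) : ∃ i, ∀ j, a j ≤ a i := by
  have : Nonempty (Fin d) := ⟨⟨0, by omega⟩⟩
  exact Finite.exists_max a

/-- The constant bounding the normalized cost of balanced boxes. -/
noncomputable def balancedConst (d : ℕ) (C D : ℝ) : ℝ := 3 * D + treeConst d C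

/-- The longest side is halved repeatedly until single points remain, where the diameter bound
applies with sides at most 3λ. -/
theorem le_of_balanced (h : IsSplitCost p C D c) (hd : 3 ≤ d) {lam : ℝ} (hlam : 0 < lam)
    {a : Fin d → ℝ} {n : ℕ} (hn : 1 ≤ n) (hpos : ∀ i, 0 < a i) (hbal : ∀ i j, a i ≤ 3 * a j)
    (hvol : ∏ i, a i = n * lam ^ d) : c a n ≤ balancedConst d C D * lam := by
  have key := h.le_of_tree hd hlam (A := 3 * D * lam) le_rfl
    (fun a n => 1 ≤ n ∧ (∀ i, 0 < a i) ∧ (∀ i j, a i ≤ 3 * a j) ∧ ∏ i, a i = n * lam ^ d)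
    (fun a n hR => hR.2.1) (fun a n hR => hR.2.2.1) (fun a n hR => hR.2.2.2) (fun a n hR => hR.1)
    (by
      clear hpos hbal hvol hn a n
      rintro a n ⟨hn, hpos, hbal, hvol⟩
      rcases Nat.lt_or_ge 1 n with hn2 | hn1
      · right
        obtain ⟨i, hi⟩ := exists_split_max hd a
        have hn0 : (n : ℝ) ≠ 0 := by positivity
        have hr : ∀ k : ℕ, (k = n / 2 ∨ k = n - n / 2) → (k : ℝ) ≤ 2 / 3 * n ∧ 1 ≤ k ∧
            (∀ j, 0 < Function.update a i (a i * ((k : ℝ) / n)) j) ∧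
            (∀ j l, Function.update a i (a i * ((k : ℝ) / n)) j ≤
              3 * Function.update a i (a i * ((k : ℝ) / n)) l) ∧
            ∏ j, Function.update a i (a i * ((k : ℝ) / n)) j = k * lam ^ d := by
          intro k hk
          obtain ⟨r1, r2, r3⟩ := half_ratio hn2 hk
          refine ⟨?_, r3, update_pos hpos (by linarith),
            balanced_update hpos hbal hi r1 (by linarith), ?_⟩
          · rwa [div_le_iff₀ (by positivity)] at r2
          · rw [prod_update_mul, hvol]; field_simp
        exact ⟨n / 2, n - n / 2, i, by omega, (hr _ (.inl rfl)).1, (hr _ (.inr rfl)).1,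
          (hr _ (.inl rfl)).2, (hr _ (.inr rfl)).2⟩
      · left
        obtain rfl : n = 1 := by omega
        refine ⟨(h.diam a 1 (3 * lam) (fun i => (hpos i).le) fun i => ?_).trans (by linarith), le_rfl⟩
        simpa using le_three_mul_of_prod_eq (by omega) hlam (by simp) hpos hbal hvol i)
    n a ⟨hn, hpos, hbal, hvol⟩
  have hn0 : (0 : ℝ) < n := by positivity
  have h1 : 0 ≤ (n : ℝ) ^ (-gapExp d) := by positivity
  have := mul_nonneg (mul_nonneg (h.treeConst_nonneg hd) hlam.le) h1
  simp only [Nat.cast_one, Real.one_rpow, mul_sub, mul_one] at key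
  unfold balancedConst
  nlinarith

/-- Tiling by unit cubes with m points each: all cuts run along the integer grid, and the total
correction depends on m but not on k. -/
theorem cube_le (h : IsSplitCost p C D c) (hd : 3 ≤ d) {m k : ℕ} (hm : 1 ≤ m) (hk : 1 ≤ k) :
    c (fun _ => (k : ℝ)) (m * k ^ d) ≤
      c 1 m + treeConst d C * (m : ℝ) ^ (-(1 / (d : ℝ))) * (m : ℝ) ^ (-gapExp d) := by
  have hm0 : (0 : ℝ) < m := by positivity
  have hlam : 0 < (m : ℝ) ^ (-(1 / (d : ℝ))) := by positivity
  have hlamd : ((m : ℝ) ^ (-(1 / (d : ℝ)))) ^ d = (m : ℝ)⁻¹ := by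
    have : (d : ℝ) ≠ 0 := by positivity
    rw [← Real.rpow_natCast, ← Real.rpow_mul hm0.le, ← Real.rpow_neg_one]
    congr 1; field_simp
  have key := h.le_of_tree hd hlam (A := c 1 m) hm
    -- The tree consists of grid boxes with integer sides and m points per cell; halving the largest
    -- integer side keeps both properties.
    (fun a n => ∃ k : Fin d → ℕ, (∀ i, 1 ≤ k i) ∧ (∀ i j, k i ≤ 3 * k j) ∧
      (a = fun i => (k i : ℝ)) ∧ n = m * ∏ i, k i)
    (by rintro a n ⟨k, h1, -, rfl, -⟩ i; have := h1 i; positivity)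
    (by rintro a n ⟨k, -, h2, rfl, -⟩ i j; simp only; exact_mod_cast h2 i j)
    (by
      rintro a n ⟨k, -, -, rfl, rfl⟩
      rw [hlamd]; push_cast; field_simp)
    (by
      rintro a n ⟨k, h1, -, -, rfl⟩
      exact Nat.le_mul_of_pos_right _ (Finset.prod_pos fun i _ => h1 i))
    (by
      clear hk k
      rintro a n ⟨k, h1, h2, rfl, rfl⟩
      have : Nonempty (Fin d) := ⟨⟨0, by omega⟩⟩
      obtain ⟨i, hi⟩ := Finite.exists_max k
      rcases Nat.lt_or_ge 1 (k i) with hk2 | hk1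
      · right
        have hprod : ∏ j, k j = k i * ∏ j ∈ Finset.univ.erase i, k j :=
          (Finset.mul_prod_erase Finset.univ k (Finset.mem_univ i)).symm
        set P := ∏ j ∈ Finset.univ.erase i, k j with hP
        have hP0 : 0 < P := Finset.prod_pos fun j _ => h1 j
        have hupd : ∀ l, ∏ j, Function.update k i l j = l * P := by
          intro l
          rw [Finset.prod_update_of_mem (Finset.mem_univ i), hP, Finset.erase_eq]
        have hr : ∀ l, (l = k i / 2 ∨ l = k i - k i / 2) →
            ((m * (l * P) : ℕ) : ℝ) ≤ 2 / 3 * ((m * ∏ j, k j : ℕ) : ℝ) ∧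
            ∃ k' : Fin d → ℕ, (∀ i, 1 ≤ k' i) ∧ (∀ i j, k' i ≤ 3 * k' j) ∧
            (Function.update (fun i => (k i : ℝ)) i
              ((k i : ℝ) * (((m * (l * P) : ℕ) : ℝ) / ((m * ∏ j, k j : ℕ) : ℝ))) =
                fun i => (k' i : ℝ)) ∧ m * (l * P) = m * ∏ i, k' i := by
          intro l hl
          obtain ⟨r1, r2, r3⟩ := half_ratio hk2 hl
          have hk0 : (0 : ℝ) < k i := by positivity
          have hP0' : (0 : ℝ) < P := by positivity
          refine ⟨?_, Function.update k i l, ?_, ?_, ?_, by rw [hupd]⟩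
          · rw [div_le_iff₀ hk0] at r2
            rw [hprod]; push_cast
            nlinarith [mul_pos hm0 hP0']
          · intro j
            rcases eq_or_ne j i with rfl | hj
            · simpa using r3
            · simpa [Function.update_of_ne hj] using h1 j
          · intro j j'
            rw [le_div_iff₀ hk0] at r1
            have r1' : k i ≤ 3 * l := by
              have : (k i : ℝ) ≤ 3 * l := by linarith
              exact_mod_cast this
            have hlk : l ≤ k i := by omega
            have b1 := h2 j j'
            have b2 := hi j
            have b3 := h2 i j'
            have b4 := h1 j'
            by_cases hj : j = i <;> by_cases hj' : j' = i
            · subst hj hj'; simp only [Function.update_self]; omega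
            · subst hj; simp only [Function.update_self, Function.update_of_ne hj']; omega
            · subst hj'; simp only [Function.update_self, Function.update_of_ne hj]; omega
            · simp only [Function.update_of_ne hj', Function.update_of_ne hj]; omega
          · have : (k i : ℝ) * (((m * (l * P) : ℕ) : ℝ) / ((m * ∏ j, k j : ℕ) : ℝ)) = (l : ℝ) := by
              rw [hprod]; push_cast; field_simp
            rw [this]
            funext j
            rcases eq_or_ne j i with rfl | hj
            · simp
            · simp [Function.update_of_ne hj]
        refine ⟨m * (k i / 2 * P), m * ((k i - k i / 2) * P), i, ?_, (hr _ (.inl rfl)).1,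
          (hr _ (.inr rfl)).1, (hr _ (.inl rfl)).2, (hr _ (.inr rfl)).2⟩
        rw [hprod, ← mul_add, ← add_mul]
        congr 2; omega
      · left
        have hk : k = fun _ => 1 := by
          funext j; have := hi j; have := h1 j; omega
        subst hk
        simp only [Finset.prod_const_one, mul_one, le_refl, and_true, Nat.cast_one]
        exact le_of_eq rfl)
    (m * k ^ d) (fun _ => (k : ℝ)) ⟨fun _ => k, fun _ => hk, fun _ _ => by simp only; omega, rfl, by simp⟩
  refine key.trans ?_
  have h1 : 0 ≤ ((m * k ^ d : ℕ) : ℝ) ^ (-gapExp d) := by positivity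
  have := mul_nonneg (mul_nonneg (h.treeConst_nonneg hd) hlam.le) h1
  rw [mul_sub]
  linarith

/-- A crude bound for a thin slab. Some side more than three times another is halved, which keeps
all sides at least w, until the box is balanced. Every cut shrinks the volume by at least 2/3, so N
cuts suffice, each paying the correction for sides at most 1 and at least (w/λ)^d points. -/
theorem le_of_unbalanced (h : IsSplitCost p C D c) (hd : 3 ≤ d) {lam w : ℝ} (hlam : 0 < lam)
    (hw : 0 < w) (hlw : 2 * lam ^ d ≤ w ^ d) (N : ℕ) :
    ∀ (a : Fin d → ℝ) (n : ℕ), 1 ≤ n → (∀ i, w ≤ a i) → (∀ i, a i ≤ 1) →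
      ∏ i, a i = n * lam ^ d → ∏ i, a i ≤ w ^ d * (3 / 2) ^ N →
      c a n ≤ balancedConst d C D * lam + N * (C * ((w / lam) ^ d) ^ (-(1 / 2) : ℝ)) := by
  have hC := h.const_nonneg
  have hE : 0 ≤ C * ((w / lam) ^ d) ^ (-(1 / 2) : ℝ) := by positivity
  induction N with
  | zero =>
    intro a n hn hwa ha1 hvol hle
    have hpos : ∀ i, 0 < a i := fun i => lt_of_lt_of_le hw (hwa i)
    -- With no cut left the volume is at most w^d, which forces a cube of side w.
    have heq : ∀ i, a i = w := by
      intro i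
      by_contra hne
      have hlt : w < a i := lt_of_le_of_ne (hwa i) (Ne.symm hne)
      have : ∏ _j : Fin d, w < ∏ j, a j :=
        Finset.prod_lt_prod (fun _ _ => hw) (fun j _ => hwa j) ⟨i, Finset.mem_univ i, hlt⟩
      simp at this hle
      linarith
    have := h.le_of_balanced hd hlam hn hpos (fun i j => by rw [heq i, heq j]; linarith) hvol
    simpa using this
  | succ N ih =>
    intro a n hn hwa ha1 hvol hle
    have hpos : ∀ i, 0 < a i := fun i => lt_of_lt_of_le hw (hwa i)
    by_cases hbal : ∀ i j, a i ≤ 3 * a j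
    · have := h.le_of_balanced hd hlam hn hpos hbal hvol
      have h2 : 0 ≤ ((N + 1 : ℕ) : ℝ) * (C * ((w / lam) ^ d) ^ (-(1 / 2) : ℝ)) := by positivity
      linarith
    · push Not at hbal
      obtain ⟨i, j, hij⟩ := hbal
      have hld : 0 < lam ^ d := by positivity
      have hnw : (w / lam) ^ d ≤ n := by
        rw [div_pow, div_le_iff₀ hld, ← hvol]
        calc w ^ d = ∏ _j : Fin d, w := by simp
          _ ≤ _ := Finset.prod_le_prod (fun _ _ => hw.le) (fun j _ => hwa j)
      have hn2 : 2 ≤ n := by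
        have : (2 : ℝ) ≤ (w / lam) ^ d := by rw [div_pow, le_div_iff₀ hld]; exact hlw
        have : (2 : ℝ) ≤ n := this.trans hnw
        exact_mod_cast this
      have hn0 : (n : ℝ) ≠ 0 := by positivity
      have hsum : n / 2 + (n - n / 2) = n := by omega
      have key : ∀ k : ℕ, (k = n / 2 ∨ k = n - n / 2) →
          c (Function.update a i (a i * ((k : ℝ) / n))) k + C * a i * (n : ℝ) ^ (-(1 / 2) : ℝ) ≤
            balancedConst d C D * lam + ((N + 1 : ℕ) : ℝ) *
              (C * ((w / lam) ^ d) ^ (-(1 / 2) : ℝ)) := by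
        intro k hk
        obtain ⟨r1, r2, r3⟩ := half_ratio hn2 hk
        have e1 := ih (Function.update a i (a i * ((k : ℝ) / n))) k r3
          (fun l => by
            rcases eq_or_ne l i with rfl | hl
            · simp only [Function.update_self]
              have := hwa j; have := hpos l; nlinarith
            · simpa [Function.update_of_ne hl] using hwa l)
          (fun l => by
            rcases eq_or_ne l i with rfl | hl
            · simp only [Function.update_self]
              have := ha1 l; have := hpos l; nlinarith
            · simpa [Function.update_of_ne hl] using ha1 l)
          (by rw [prod_update_mul, hvol]; field_simp)
          (by
            rw [prod_update_mul]
            have h0 : 0 < ∏ j, a j := Finset.prod_pos fun j _ => hpos j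
            rw [pow_succ] at hle
            have : (∏ j, a j) * ((k : ℝ) / n) ≤ (∏ j, a j) * (2 / 3) :=
              mul_le_mul_of_nonneg_left r2 h0.le
            linarith)
        have e2 : C * a i * (n : ℝ) ^ (-(1 / 2) : ℝ) ≤ C * ((w / lam) ^ d) ^ (-(1 / 2) : ℝ) := by
          have e3 : (n : ℝ) ^ (-(1 / 2) : ℝ) ≤ ((w / lam) ^ d) ^ (-(1 / 2) : ℝ) :=
            Real.rpow_le_rpow_of_nonpos (by positivity) hnw (by norm_num)
          have := ha1 i
          calc C * a i * (n : ℝ) ^ (-(1 / 2) : ℝ) ≤ C * 1 * ((w / lam) ^ d) ^ (-(1 / 2) : ℝ) := by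
                gcongr
            _ = _ := by ring
        push_cast
        linarith
      have k1 := key _ (.inl rfl)
      have k2 := key _ (.inr rfl)
      have := h.le_of_children (i := i) (n₁ := n / 2) (n₂ := n - n / 2) hpos (by omega) (by omega)
        (T := balancedConst d C D * lam + ((N + 1 : ℕ) : ℝ) *
              (C * ((w / lam) ^ d) ^ (-(1 / 2) : ℝ)))
        (by rw [hsum]; exact k1) (by rw [hsum]; exact k2)
      rwa [hsum] at this

end IsSplitCost

/-! ### Convergence of the normalized split cost -/

theorem eventually_exists_cube_count {d m : ℕ} (hd : d ≠ 0) (hm : 1 ≤ m) {δ : ℝ} (hδ : 0 < δ)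
    (hδ2 : δ < 1 / 2) :
    ∀ᶠ n : ℕ in atTop, ∃ k : ℕ, 1 ≤ k ∧ ((m * k ^ d : ℕ) : ℝ) ≤ (1 - δ) * n ∧
      (1 - 2 * δ) * n ≤ ((m * k ^ d : ℕ) : ℝ) := by
  have hm0 : (0 : ℝ) < m := by positivity
  have hd0 : (d : ℝ) ≠ 0 := by exact_mod_cast hd
  have h1 : Tendsto (fun n : ℕ => ((1 - δ) / m * (n : ℝ)) ^ (1 / (d : ℝ))) atTop atTop := by
    refine (tendsto_rpow_atTop (by positivity)).comp ?_
    exact Tendsto.const_mul_atTop (div_pos (by linarith) hm0) tendsto_natCast_atTop_atTop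
  have h2 : Tendsto (fun x : ℝ => ((⌊x⌋₊ : ℝ) / x) ^ d) atTop (𝓝 1) := by
    simpa using (tendsto_nat_floor_div_atTop (R := ℝ)).pow d
  have h3 : ∀ᶠ x : ℝ in atTop, (1 - 2 * δ) / (1 - δ) < ((⌊x⌋₊ : ℝ) / x) ^ d :=
    h2.eventually_const_lt (by rw [div_lt_one (by linarith)]; linarith)
  -- The witness is the integer part of the solution x of m·x^d = (1 - δ)·n; rounding loses a factor
  -- tending to 1.
  filter_upwards [h1.eventually (h3.and (eventually_ge_atTop 1))] with n hn
  set x := ((1 - δ) / m * (n : ℝ)) ^ (1 / (d : ℝ)) with hx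
  have hx0 : 0 < x := by linarith [hn.2]
  have hxd : m * x ^ d = (1 - δ) * n := by
    have : 0 ≤ (1 - δ) / m * (n : ℝ) :=
      mul_nonneg (div_nonneg (by linarith) hm0.le) (Nat.cast_nonneg _)
    rw [hx, ← Real.rpow_natCast, ← Real.rpow_mul this, one_div_mul_cancel hd0, Real.rpow_one]
    field_simp
  refine ⟨⌊x⌋₊, Nat.floor_pos.2 hn.2, ?_, ?_⟩
  · push_cast
    rw [← hxd]
    have := Nat.floor_le hx0.le
    gcongr
  · have h5 := hn.1
    rw [div_pow, div_lt_div_iff₀ (by linarith) (by positivity)] at h5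
    push_cast
    have h6 : (1 - 2 * δ) * (m * x ^ d) < m * (⌊x⌋₊ : ℝ) ^ d * (1 - δ) := by nlinarith
    rw [hxd] at h6
    have h7 : (1 - δ) * ((1 - 2 * δ) * n) < (1 - δ) * (m * (⌊x⌋₊ : ℝ) ^ d) := by linarith
    exact (lt_of_mul_lt_mul_left h7 (by linarith)).le

namespace IsSplitCost

variable {d : ℕ} {p C D : ℝ} {c : (Fin d → ℝ) → ℕ → ℝ}

theorem rpow_pow_inv {d : ℕ} (hd : d ≠ 0) {x : ℝ} (hx : 0 ≤ x) :
    (x ^ (-(1 / (d : ℝ)))) ^ d = x⁻¹ := by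
  have : (d : ℝ) ≠ 0 := by positivity
  rw [← Real.rpow_natCast, ← Real.rpow_mul hx, ← Real.rpow_neg_one]
  congr 1; field_simp

theorem rpow_mul_rpow_neg_half {d : ℕ} {n : ℝ} (hn : 0 < n) :
    n ^ (1 / (d : ℝ)) * n ^ (-(1 / 2) : ℝ) = n ^ (-gapExp d) := by
  rw [← Real.rpow_add hn]; congr 1; unfold gapExp; ring

theorem normalized_le (h : IsSplitCost p C D c) (hd : 3 ≤ d) {n : ℕ} (hn : 1 ≤ n) :
    (n : ℝ) ^ (1 / (d : ℝ)) * c 1 n ≤ balancedConst d C D := by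
  have hn0 : (0 : ℝ) < n := by positivity
  have := h.le_of_balanced hd (lam := (n : ℝ) ^ (-(1 / (d : ℝ)))) (a := 1) (by positivity) hn
    (by simp) (by simp) (by rw [rpow_pow_inv (by omega) hn0.le]; simp [hn0.ne'])
  calc _ ≤ (n : ℝ) ^ (1 / (d : ℝ)) * (balancedConst d C D * (n : ℝ) ^ (-(1 / (d : ℝ)))) := by gcongr
    _ = balancedConst d C D * ((n : ℝ) ^ (1 / (d : ℝ)) * (n : ℝ) ^ (-(1 / (d : ℝ)))) := by ring
    _ = _ := by rw [← Real.rpow_add hn0]; simp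

/-- One cut separates m·k^d points, treated by `cube_le`, from a slab of weight at most 2δ, treated
by `le_of_unbalanced`. `K` depends on δ, but it is multiplied by a vanishing power of n. -/
theorem normalized_rpow_le (h : IsSplitCost p C D c) (hd : 3 ≤ d) {m : ℕ} (hm : 1 ≤ m) {δ : ℝ}
    (hδ : 0 < δ) (hδ2 : δ < 1 / 2) :
    ∃ K : ℝ, ∀ᶠ n : ℕ in atTop, ((n : ℝ) ^ (1 / (d : ℝ)) * c 1 n) ^ p ≤
      ((1 - 2 * δ) ^ (-(1 / (d : ℝ))) * ((m : ℝ) ^ (1 / (d : ℝ)) * c 1 m +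
        treeConst d C * (m : ℝ) ^ (-gapExp d)) + C * (n : ℝ) ^ (-gapExp d)) ^ p +
      2 * δ * (balancedConst d C D + K * (n : ℝ) ^ (-gapExp d)) ^ p := by
  have hd0 : d ≠ 0 := by omega
  have hdR : (d : ℝ) ≠ 0 := by exact_mod_cast hd0
  have hC := h.const_nonneg
  have hp : 0 < p := by linarith [h.one_le]
  have hm0 : (0 : ℝ) < m := by positivity
  -- N bounds the number of cuts that balance a slab of thickness at least δ inside the unit cube.
  obtain ⟨N, hN⟩ : ∃ N : ℕ, (δ ^ d)⁻¹ < (3 / 2 : ℝ) ^ N := pow_unbounded_of_one_lt _ (by norm_num)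
  have hδd : 0 < δ ^ d := by positivity
  have hN1 : 1 ≤ δ ^ d * (3 / 2) ^ N := by
    have := mul_le_mul_of_nonneg_left hN.le hδd.le
    rwa [mul_inv_cancel₀ hδd.ne'] at this
  refine ⟨N * (C * (δ ^ d) ^ (-(1 / 2) : ℝ)) + C, ?_⟩
  have hlarge : ∀ᶠ n : ℕ in atTop, 2 / δ ^ d ≤ (n : ℝ) :=
    tendsto_natCast_atTop_atTop.eventually (eventually_ge_atTop _)
  filter_upwards [eventually_exists_cube_count hd0 hm hδ hδ2, hlarge, eventually_ge_atTop 1]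
    with n hk hnl hn1
  obtain ⟨k, hk1, hku, hkl⟩ := hk
  have hn0 : (0 : ℝ) < n := by positivity
  have hk0 : (0 : ℝ) < k := by positivity
  set n₁ := m * k ^ d with hn₁
  have hle : n₁ ≤ n := by
    have : (n₁ : ℝ) ≤ n := by nlinarith
    exact_mod_cast this
  obtain ⟨r, rfl⟩ := Nat.exists_eq_add_of_le hle
  have hrl : δ * ((n₁ + r : ℕ) : ℝ) ≤ r := by push_cast at hku ⊢; linarith
  have hru : (r : ℝ) ≤ 2 * δ * ((n₁ + r : ℕ) : ℝ) := by push_cast at hkl ⊢; linarith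
  have hr0 : (0 : ℝ) < r := lt_of_lt_of_le (by positivity) hrl
  have hr1 : 1 ≤ r := by exact_mod_cast hr0
  have hn₁1 : 1 ≤ n₁ := by rw [hn₁]; exact Nat.mul_pos hm (pow_pos hk1 _)
  set i : Fin d := ⟨0, by omega⟩
  have hs := h.split 1 n₁ r i (by simp) hn₁1 hr1
  set n := n₁ + r with hnn
  have hsum : (n : ℝ) = n₁ + r := by rw [hnn]; push_cast; ring
  simp only [Pi.one_apply, one_mul, mul_one] at hs
  set c₁ := c (Function.update 1 i ((n₁ : ℝ) / n)) n₁ with hc₁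
  set c₂ := c (Function.update 1 i ((r : ℝ) / n)) r with hc₂
  have hq1 : (n₁ : ℝ) / n ≤ 1 := by rw [div_le_one hn0]; linarith
  have hq2 : (r : ℝ) / n ≤ 1 := by
    have : (0 : ℝ) ≤ n₁ := Nat.cast_nonneg _
    rw [div_le_one hn0]; linarith
  have hc10 : 0 ≤ c₁ := h.nonneg _ _
  have hc20 : 0 ≤ c₂ := h.nonneg _ _
  have b1 : (n : ℝ) ^ (1 / (d : ℝ)) * c₁ ≤ (1 - 2 * δ) ^ (-(1 / (d : ℝ))) *
      ((m : ℝ) ^ (1 / (d : ℝ)) * c 1 m + treeConst d C * (m : ℝ) ^ (-gapExp d)) := by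
    -- The main part is slightly thinner than the unit cube; monotonicity restores the cube so that
    -- scaling by k applies.
    have e1 : c₁ ≤ c 1 n₁ := by
      refine h.mono _ _ _ (fun j => ?_) (fun j => ?_)
      · rcases eq_or_ne j i with rfl | hj
        · simp; positivity
        · simp [Function.update_of_ne hj]
      · rcases eq_or_ne j i with rfl | hj
        · simpa using hq1
        · simp [Function.update_of_ne hj]
    have e2 : k * c 1 n₁ ≤
        c 1 m + treeConst d C * (m : ℝ) ^ (-(1 / (d : ℝ))) * (m : ℝ) ^ (-gapExp d) := by
      rw [← h.smul _ _ _ hk0]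
      have := h.cube_le hd hm hk1
      have e : ((k : ℝ) • (1 : Fin d → ℝ)) = fun _ => (k : ℝ) := by funext j; simp
      rwa [e]
    have hb : 0 < 1 - 2 * δ := by linarith
    have e3 : (n : ℝ) ^ (1 / (d : ℝ)) ≤
        (1 - 2 * δ) ^ (-(1 / (d : ℝ))) * (m : ℝ) ^ (1 / (d : ℝ)) * k := by
      have : (n : ℝ) ≤ (1 - 2 * δ)⁻¹ * (m * (k : ℝ) ^ d) := by
        rw [hn₁] at hkl; push_cast at hkl
        rw [inv_mul_eq_div, le_div_iff₀ hb]; linarith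
      calc (n : ℝ) ^ (1 / (d : ℝ)) ≤ ((1 - 2 * δ)⁻¹ * (m * (k : ℝ) ^ d)) ^ (1 / (d : ℝ)) := by gcongr
        _ = _ := by
          rw [Real.mul_rpow (by positivity) (by positivity), Real.mul_rpow hm0.le (by positivity),
            Real.inv_rpow hb.le, ← Real.rpow_neg hb.le, ← Real.rpow_natCast (k : ℝ),
            ← Real.rpow_mul hk0.le, mul_one_div_cancel hdR, Real.rpow_one, mul_assoc]
    have e4 : (m : ℝ) ^ (1 / (d : ℝ)) * (m : ℝ) ^ (-(1 / (d : ℝ))) = 1 := by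
      rw [← Real.rpow_add hm0]; simp
    calc (n : ℝ) ^ (1 / (d : ℝ)) * c₁
        ≤ ((1 - 2 * δ) ^ (-(1 / (d : ℝ))) * (m : ℝ) ^ (1 / (d : ℝ)) * k) * c 1 n₁ := by gcongr
      _ = ((1 - 2 * δ) ^ (-(1 / (d : ℝ))) * (m : ℝ) ^ (1 / (d : ℝ))) * (k * c 1 n₁) := by ring
      _ ≤ ((1 - 2 * δ) ^ (-(1 / (d : ℝ))) * (m : ℝ) ^ (1 / (d : ℝ))) * (c 1 m +
          treeConst d C * (m : ℝ) ^ (-(1 / (d : ℝ))) * (m : ℝ) ^ (-gapExp d)) := by gcongr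
      _ = (1 - 2 * δ) ^ (-(1 / (d : ℝ))) * ((m : ℝ) ^ (1 / (d : ℝ)) * c 1 m + treeConst d C *
          ((m : ℝ) ^ (1 / (d : ℝ)) * (m : ℝ) ^ (-(1 / (d : ℝ)))) * (m : ℝ) ^ (-gapExp d)) := by ring
      _ = _ := by rw [e4, mul_one]
  have hlamd : ((n : ℝ) ^ (-(1 / (d : ℝ)))) ^ d = (n : ℝ)⁻¹ := rpow_pow_inv hd0 hn0.le
  have hlam1 : (n : ℝ) ^ (1 / (d : ℝ)) * (n : ℝ) ^ (-(1 / (d : ℝ))) = 1 := by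
    rw [← Real.rpow_add hn0]; simp
  have b2 : (n : ℝ) ^ (1 / (d : ℝ)) * c₂ ≤ balancedConst d C D +
      N * (C * (δ ^ d) ^ (-(1 / 2) : ℝ)) * (n : ℝ) ^ (-gapExp d) := by
    have hprod : ∏ j, Function.update (1 : Fin d → ℝ) i ((r : ℝ) / n) j = (r : ℝ) / n := by
      have := prod_update_mul (1 : Fin d → ℝ) i ((r : ℝ) / n)
      simpa using this
    have hδr : δ ≤ (r : ℝ) / n := by rw [le_div_iff₀ hn0]; exact hrl
    have := h.le_of_unbalanced hd (lam := (n : ℝ) ^ (-(1 / (d : ℝ)))) (w := δ) (by positivity) hδ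
      (by
        rw [hlamd, ← div_eq_mul_inv, div_le_iff₀ hn0]
        rwa [div_le_iff₀ hδd, mul_comm] at hnl) N (Function.update 1 i ((r : ℝ) / n)) r hr1
      (fun j => by
        rcases eq_or_ne j i with rfl | hj
        · simpa using hδr
        · simp [Function.update_of_ne hj]; linarith)
      (fun j => by
        rcases eq_or_ne j i with rfl | hj
        · simpa using hq2
        · simp [Function.update_of_ne hj])
      (by rw [hprod, hlamd, div_eq_mul_inv]) (by rw [hprod]; exact hq2.trans hN1)
    rw [← hc₂, div_pow, hlamd, div_inv_eq_mul, Real.mul_rpow hδd.le hn0.le] at this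
    calc (n : ℝ) ^ (1 / (d : ℝ)) * c₂ ≤ (n : ℝ) ^ (1 / (d : ℝ)) *
          (balancedConst d C D * (n : ℝ) ^ (-(1 / (d : ℝ))) +
            N * (C * ((δ ^ d) ^ (-(1 / 2) : ℝ) * (n : ℝ) ^ (-(1 / 2) : ℝ)))) := by gcongr
      _ = balancedConst d C D * ((n : ℝ) ^ (1 / (d : ℝ)) * (n : ℝ) ^ (-(1 / (d : ℝ)))) +
            N * (C * (δ ^ d) ^ (-(1 / 2) : ℝ)) *
              ((n : ℝ) ^ (1 / (d : ℝ)) * (n : ℝ) ^ (-(1 / 2) : ℝ)) := by ring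
      _ = _ := by rw [hlam1, rpow_mul_rpow_neg_half hn0, mul_one]
  have hX : ∀ x : ℝ, 0 ≤ x → ((n : ℝ) ^ (1 / (d : ℝ)) * x + C * (n : ℝ) ^ (-gapExp d)) ^ p =
      ((n : ℝ) ^ (1 / (d : ℝ))) ^ p * (x + C * (n : ℝ) ^ (-(1 / 2) : ℝ)) ^ p := by
    intro x hx
    rw [← Real.mul_rpow (by positivity) (by positivity), ← rpow_mul_rpow_neg_half hn0]
    congr 1; ring
  have main : ((n : ℝ) ^ (1 / (d : ℝ)) * c 1 n) ^ p ≤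
      (n₁ : ℝ) / n * ((n : ℝ) ^ (1 / (d : ℝ)) * c₁ + C * (n : ℝ) ^ (-gapExp d)) ^ p +
      (r : ℝ) / n * ((n : ℝ) ^ (1 / (d : ℝ)) * c₂ + C * (n : ℝ) ^ (-gapExp d)) ^ p := by
    rw [hX _ hc10, hX _ hc20, Real.mul_rpow (by positivity) (h.nonneg _ _)]
    have hA : 0 < ((n : ℝ) ^ (1 / (d : ℝ))) ^ p / n := by positivity
    have := mul_le_mul_of_nonneg_left hs hA.le
    calc _ = ((n : ℝ) ^ (1 / (d : ℝ))) ^ p / n * (n * c 1 n ^ p) := by field_simp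
      _ ≤ _ := this
      _ = _ := by ring
  refine main.trans (add_le_add ?_ ?_)
  · calc _ ≤ 1 * ((n : ℝ) ^ (1 / (d : ℝ)) * c₁ + C * (n : ℝ) ^ (-gapExp d)) ^ p := by gcongr
      _ ≤ _ := by rw [one_mul]; gcongr
  · have : (r : ℝ) / n ≤ 2 * δ := by rw [div_le_iff₀ hn0]; exact hru
    refine mul_le_mul this (Real.rpow_le_rpow (by positivity) ?_ hp.le) (by positivity)
      (by positivity)
    rw [add_mul]; linarith

theorem tendsto_natCast_rpow_neg {γ : ℝ} (hγ : 0 < γ) :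
    Tendsto (fun n : ℕ => (n : ℝ) ^ (-γ)) atTop (𝓝 0) :=
  (tendsto_rpow_neg_atTop hγ).comp tendsto_natCast_atTop_atTop

/-- δ is fixed first, small enough to retain the strict inequality, and then n tends to infinity. -/
theorem eventually_normalized_rpow_lt (h : IsSplitCost p C D c) (hd : 3 ≤ d) {m : ℕ} (hm : 1 ≤ m)
    {e : ℝ} (he : ((m : ℝ) ^ (1 / (d : ℝ)) * c 1 m +
      treeConst d C * (m : ℝ) ^ (-gapExp d)) ^ p < e) :
    ∀ᶠ n : ℕ in atTop, ((n : ℝ) ^ (1 / (d : ℝ)) * c 1 n) ^ p < e := by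
  have hp : 0 < p := by linarith [h.one_le]
  set G := (m : ℝ) ^ (1 / (d : ℝ)) * c 1 m + treeConst d C * (m : ℝ) ^ (-gapExp d) with hG
  have hcont : Tendsto (fun δ : ℝ => ((1 - 2 * δ) ^ (-(1 / (d : ℝ))) * G) ^ p +
      2 * δ * (balancedConst d C D) ^ p) (𝓝[>] 0) (𝓝 (G ^ p)) := by
    have : ContinuousAt (fun δ : ℝ => ((1 - 2 * δ) ^ (-(1 / (d : ℝ))) * G) ^ p +
        2 * δ * (balancedConst d C D) ^ p) 0 := by
      refine ContinuousAt.add (ContinuousAt.rpow_const (ContinuousAt.mul (ContinuousAt.rpow_const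
        (by fun_prop) (.inl (by norm_num))) (by fun_prop)) (.inr hp.le)) (by fun_prop)
    have h2 := this.tendsto
    simp only [mul_zero, sub_zero, Real.one_rpow, one_mul, zero_mul, add_zero] at h2
    exact h2.mono_left nhdsWithin_le_nhds
  have hev : ∀ᶠ δ : ℝ in 𝓝[>] 0, 0 < δ ∧ δ < 1 / 2 ∧
      ((1 - 2 * δ) ^ (-(1 / (d : ℝ))) * G) ^ p + 2 * δ * (balancedConst d C D) ^ p < e := by
    filter_upwards [self_mem_nhdsWithin, nhdsWithin_le_nhds (Iio_mem_nhds (by norm_num :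
      (0 : ℝ) < 1 / 2)), hcont.eventually_lt_const he] with δ h1 h2 h3
    exact ⟨h1, h2, h3⟩
  obtain ⟨δ, hδ, hδ2, hlt⟩ := hev.exists
  obtain ⟨K, hK⟩ := h.normalized_rpow_le hd hm hδ hδ2
  have hs := tendsto_natCast_rpow_neg (gapExp_pos hd)
  have hF : Tendsto (fun n : ℕ => ((1 - 2 * δ) ^ (-(1 / (d : ℝ))) * G +
      C * (n : ℝ) ^ (-gapExp d)) ^ p + 2 * δ * (balancedConst d C D +
      K * (n : ℝ) ^ (-gapExp d)) ^ p) atTop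
      (𝓝 (((1 - 2 * δ) ^ (-(1 / (d : ℝ))) * G) ^ p + 2 * δ * (balancedConst d C D) ^ p)) := by
    have h1 := ((hs.const_mul C).const_add ((1 - 2 * δ) ^ (-(1 / (d : ℝ))) * G)).rpow_const
      (p := p) (.inr hp.le)
    have h2 := (((hs.const_mul K).const_add (balancedConst d C D)).rpow_const
      (p := p) (.inr hp.le)).const_mul (2 * δ)
    simpa using h1.add h2
  filter_upwards [hK, hF.eventually_lt_const hlt] with n h1 h2
  exact h1.trans_lt h2

/-- The normalized cost of the unit cube converges. -/
theorem exists_tendsto (h : IsSplitCost p C D c) (hd : 3 ≤ d) :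
    ∃ L : ℝ, Tendsto (fun n : ℕ => (n : ℝ) ^ (1 / (d : ℝ)) * c 1 n) atTop (𝓝 L) := by
  have hp : 0 < p := by linarith [h.one_le]
  set g : ℕ → ℝ := fun n => (n : ℝ) ^ (1 / (d : ℝ)) * c 1 n with hg
  have hg0 : ∀ n, 0 ≤ g n := fun n => mul_nonneg (by positivity) (h.nonneg _ _)
  have hbd : IsBoundedUnder (· ≥ ·) atTop g := ⟨0, by simpa using ⟨0, fun n _ => hg0 n⟩⟩
  have hbd' : IsBoundedUnder (· ≤ ·) atTop g :=
    ⟨balancedConst d C D, by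
      simpa using ⟨1, fun n hn => h.normalized_le hd hn⟩⟩
  -- Only the upper bound needs work: a single m with g m close to the liminf and with a small
  -- correction controls all large n.
  refine ⟨liminf g atTop, tendsto_order.2 ⟨fun b hb => eventually_lt_of_lt_liminf hb hbd, fun b hb => ?_⟩⟩
  obtain ⟨b', hb1, hb2⟩ := exists_between hb
  have hfreq : ∃ᶠ n in atTop, g n < b' := frequently_lt_of_liminf_lt hbd'.isCoboundedUnder_ge hb1
  have hs : Tendsto (fun n : ℕ => treeConst d C * (n : ℝ) ^ (-gapExp d)) atTop (𝓝 0) := by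
    simpa using (tendsto_natCast_rpow_neg (gapExp_pos hd)).const_mul (treeConst d C)
  obtain ⟨m, hm1, hm2, hm3⟩ := (hfreq.and_eventually
    ((hs.eventually_lt_const (sub_pos.2 hb2)).and (eventually_ge_atTop 1))).exists
  have hb0 : 0 < b := by linarith [hg0 m]
  have hlt : (g m + treeConst d C * (m : ℝ) ^ (-gapExp d)) ^ p < b ^ p := by
    refine Real.rpow_lt_rpow (add_nonneg (hg0 m) (mul_nonneg (h.treeConst_nonneg hd)
      (by positivity))) (by linarith) hp
  filter_upwards [h.eventually_normalized_rpow_lt hd hm3 hlt] with n hn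
  exact (Real.rpow_lt_rpow_iff (hg0 n) hb0.le hp).1 hn

end IsSplitCost

/-! ### Matching cost with extended real values -/

section MatchCost

variable {κ κ' E : Type*} [Fintype κ] [Fintype κ'] [PseudoEMetricSpace E]

/-- The extended-real minimal matching cost between two families of points. -/
noncomputable def matchCost (p : ℝ) (x y : κ → E) : ℝ≥0∞ :=
  ⨅ π : Equiv.Perm κ, ∑ j, edist (x j) (y (π j)) ^ p

theorem matchCost_le (p : ℝ) (x y : κ → E) (π : Equiv.Perm κ) :
    matchCost p x y ≤ ∑ j, edist (x j) (y (π j)) ^ p := iInf_le _ π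

theorem exists_matchCost_eq (p : ℝ) (x y : κ → E) :
    ∃ π : Equiv.Perm κ, matchCost p x y = ∑ j, edist (x j) (y (π j)) ^ p := by
  obtain ⟨π, hπ⟩ := exists_eq_ciInf_of_finite
    (f := fun π : Equiv.Perm κ => ∑ j, edist (x j) (y (π j)) ^ p)
  exact ⟨π, hπ.symm⟩

theorem matchCost_comp_equiv_le (p : ℝ) (x y : κ → E) (e e' : κ' ≃ κ) :
    matchCost p (x ∘ e) (y ∘ e') ≤ matchCost p x y := by
  obtain ⟨π, hπ⟩ := exists_matchCost_eq p x y
  rw [hπ]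
  refine (matchCost_le p _ _ ((e.trans π).trans e'.symm)).trans (le_of_eq ?_)
  simp only [Function.comp_apply, Equiv.trans_apply, Equiv.apply_symm_apply]
  exact e.sum_comp fun j => edist (x j) (y (π j)) ^ p

theorem matchCost_comp_equiv (p : ℝ) (x y : κ → E) (e e' : κ' ≃ κ) :
    matchCost p (x ∘ e) (y ∘ e') = matchCost p x y := by
  refine le_antisymm (matchCost_comp_equiv_le p x y e e') ?_
  have := matchCost_comp_equiv_le p (x ∘ e) (y ∘ e') e.symm e'.symm
  simpa [Function.comp_assoc] using this

theorem matchCost_sum_le (p : ℝ) (x y : κ ⊕ κ' → E) :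
    matchCost p x y ≤ matchCost p (x ∘ Sum.inl) (y ∘ Sum.inl) +
      matchCost p (x ∘ Sum.inr) (y ∘ Sum.inr) := by
  obtain ⟨π, hπ⟩ := exists_matchCost_eq p (x ∘ Sum.inl) (y ∘ Sum.inl)
  obtain ⟨π', hπ'⟩ := exists_matchCost_eq p (x ∘ Sum.inr) (y ∘ Sum.inr)
  refine (matchCost_le p _ _ (Equiv.sumCongr π π')).trans (le_of_eq ?_)
  rw [hπ, hπ', Fintype.sum_sum_type]
  simp

theorem matchCost_mono {E' : Type*} [PseudoEMetricSpace E'] {p : ℝ} (hp : 0 ≤ p) {x y : κ → E}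
    {x' y' : κ → E'} (h : ∀ j k, edist (x j) (y k) ≤ edist (x' j) (y' k)) :
    matchCost p x y ≤ matchCost p x' y' :=
  iInf_mono fun _ => Finset.sum_le_sum fun _ _ => ENNReal.rpow_le_rpow (h _ _) hp

theorem matchCost_le_card_mul {p : ℝ} (hp : 0 ≤ p) {x y : κ → E} {r : ℝ≥0∞}
    (h : ∀ j k, edist (x j) (y k) ≤ r) : matchCost p x y ≤ Fintype.card κ * r ^ p := by
  refine (matchCost_le p x y (Equiv.refl κ)).trans ?_
  refine (Finset.sum_le_sum fun j _ => ENNReal.rpow_le_rpow (h j _) hp).trans ?_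
  simp

theorem matchCost_smul {F : Type*} [SeminormedAddCommGroup F] [NormedSpace ℝ F] {p : ℝ}
    (hp : 0 ≤ p) {t : ℝ} (ht : 0 < t) (x y : κ → F) :
    matchCost p (fun j => t • x j) (fun j => t • y j) =
      ENNReal.ofReal t ^ p * matchCost p x y := by
  unfold matchCost
  rw [ENNReal.mul_iInf_of_ne (by simp [ht]) (ENNReal.rpow_ne_top_of_nonneg hp (by simp))]
  refine iInf_congr fun π => ?_
  rw [Finset.mul_sum]
  refine Finset.sum_congr rfl fun j _ => ?_
  rw [edist_smul₀, ENNReal.smul_def, smul_eq_mul, ENNReal.mul_rpow_of_nonneg _ _ hp]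
  congr 2
  rw [Real.nnnorm_of_nonneg ht.le, ENNReal.ofReal]
  congr 1
  ext; simp [ht.le]

/-- The permutation optimal for the displaced points is used for the original ones; then Minkowski
in ℓ^p. Reindexing by the permutation removes it from the displacement of y. -/
theorem matchCost_rpow_le {p : ℝ} (hp : 1 ≤ p) (x y x' y' : κ → E) :
    matchCost p x y ^ (1 / p) ≤ matchCost p x' y' ^ (1 / p) +
      ((∑ j, edist (x j) (x' j) ^ p) ^ (1 / p) + (∑ j, edist (y j) (y' j) ^ p) ^ (1 / p)) := by
  have hp0 : 0 ≤ p := by linarith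
  have hp1 : 0 ≤ 1 / p := by positivity
  obtain ⟨π, hπ⟩ := exists_matchCost_eq p x' y'
  have h1 : matchCost p x y ≤ ∑ j, (edist (x' j) (y' (π j)) +
      (edist (x j) (x' j) + edist (y (π j)) (y' (π j)))) ^ p := by
    refine (matchCost_le p x y π).trans (Finset.sum_le_sum fun j _ => ENNReal.rpow_le_rpow ?_ hp0)
    calc edist (x j) (y (π j)) ≤ edist (x j) (x' j) + edist (x' j) (y' (π j)) +
          edist (y' (π j)) (y (π j)) := edist_triangle4 _ _ _ _
      _ = _ := by rw [edist_comm (y' (π j))]; ring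
  have h2 : (∑ j, edist (y (π j)) (y' (π j)) ^ p) = ∑ j, edist (y j) (y' j) ^ p :=
    Equiv.sum_comp π fun j => edist (y j) (y' j) ^ p
  rw [hπ, ← h2]
  refine (ENNReal.rpow_le_rpow h1 hp1).trans ((ENNReal.Lp_add_le Finset.univ _ _ hp).trans ?_)
  gcongr
  exact ENNReal.Lp_add_le Finset.univ _ _ hp

theorem measurable_matchCost {Ω : Type*} [MeasurableSpace Ω] [MeasurableSpace E]
    [OpensMeasurableSpace E] [SecondCountableTopology E] (p : ℝ) {x y : Ω → κ → E}
    (hx : ∀ j, Measurable fun ω => x ω j) (hy : ∀ j, Measurable fun ω => y ω j) :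
    Measurable fun ω => matchCost p (x ω) (y ω) :=
  .iInf fun _ => Finset.measurable_fun_sum _ fun j _ => ((hx j).edist (hy _)).pow_const p

end MatchCost

/-! ### Uniform points in rescaled boxes -/

section Boxes

variable {d : ℕ} {κ κ' : Type*} [Fintype κ] [Fintype κ']

/-- The image in Euclidean space of a point under coordinatewise scaling by `a`. -/
noncomputable def scaleEmb (a x : Fin d → ℝ) : EuclideanSpace ℝ (Fin d) := WithLp.toLp 2 (a * x)

theorem edist_scaleEmb_le {a b x y x' y' : Fin d → ℝ}
    (h : ∀ i, |a i * x i - a i * y i| ≤ |b i * x' i - b i * y' i|) :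
    edist (scaleEmb a x) (scaleEmb a y) ≤ edist (scaleEmb b x') (scaleEmb b y') := by
  rw [edist_dist, edist_dist]
  refine ENNReal.ofReal_le_ofReal ?_
  rw [EuclideanSpace.dist_eq, EuclideanSpace.dist_eq]
  refine Real.sqrt_le_sqrt (Finset.sum_le_sum fun i _ => ?_)
  simp only [scaleEmb, Pi.mul_apply, Real.dist_eq]
  exact pow_le_pow_left₀ (abs_nonneg _) (h i) 2

theorem edist_scaleEmb_le_of_mem {a x y : Fin d → ℝ} {K : ℝ} (ha : ∀ i, 0 ≤ a i) (hK : ∀ i, a i ≤ K)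
    (hx : ∀ i, x i ∈ Set.Icc (0 : ℝ) 1) (hy : ∀ i, y i ∈ Set.Icc (0 : ℝ) 1) :
    edist (scaleEmb a x) (scaleEmb a y) ≤ ENNReal.ofReal (√d * K) := by
  rcases Nat.eq_zero_or_pos d with rfl | hd
  · rw [Subsingleton.elim (scaleEmb a x) (scaleEmb a y)]; simp
  have hK0 : 0 ≤ K := (ha ⟨0, hd⟩).trans (hK _)
  rw [edist_dist, EuclideanSpace.dist_eq]
  refine ENNReal.ofReal_le_ofReal ?_
  rw [← Real.sqrt_sq hK0, ← Real.sqrt_mul (by positivity)]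
  refine Real.sqrt_le_sqrt ?_
  calc _ ≤ ∑ _i : Fin d, K ^ 2 := Finset.sum_le_sum fun i _ => ?_
    _ = _ := by simp
  simp only [scaleEmb, Pi.mul_apply, Real.dist_eq, ← mul_sub, abs_mul, abs_of_nonneg (ha i)]
  refine pow_le_pow_left₀ (by have := ha i; positivity) ?_ 2
  have h1 : |x i - y i| ≤ 1 := by
    have := hx i; have := hy i
    rw [abs_le]; constructor <;> linarith [(hx i).1, (hx i).2, (hy i).1, (hy i).2]
  calc a i * |x i - y i| ≤ K * 1 := mul_le_mul (hK i) h1 (abs_nonneg _) hK0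
    _ = K := mul_one _

theorem scaleEmb_mul (a b x : Fin d → ℝ) : scaleEmb a (b * x) = scaleEmb (a * b) x := by
  simp [scaleEmb, mul_assoc]

theorem scaleEmb_smul (t : ℝ) (a x : Fin d → ℝ) : scaleEmb (t • a) x = t • scaleEmb a x := by
  simp [scaleEmb]

@[fun_prop]
theorem measurable_scaleEmb {Ω : Type*} [MeasurableSpace Ω] {a x : Ω → Fin d → ℝ}
    (ha : Measurable a) (hx : Measurable x) : Measurable fun ω => scaleEmb (a ω) (x ω) :=
  (WithLp.measurable_toLp 2 _).comp (ha.mul hx)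

/-- The matching cost of two families of points rescaled to a box with side lengths `a`. -/
noncomputable def boxCost (p : ℝ) (a : Fin d → ℝ) (x y : κ → Fin d → ℝ) : ℝ≥0∞ :=
  matchCost p (fun j => scaleEmb a (x j)) (fun j => scaleEmb a (y j))

theorem measurable_boxCost {Ω : Type*} [MeasurableSpace Ω] (p : ℝ) (a : Fin d → ℝ)
    {x y : Ω → κ → Fin d → ℝ} (hx : Measurable x) (hy : Measurable y) :
    Measurable fun ω => boxCost p a (x ω) (y ω) :=
  measurable_matchCost p (fun j => measurable_scaleEmb measurable_const (by fun_prop))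
    (fun j => measurable_scaleEmb measurable_const (by fun_prop))

theorem boxCost_comp_equiv (p : ℝ) (a : Fin d → ℝ) (x y : κ → Fin d → ℝ) (e e' : κ' ≃ κ) :
    boxCost p a (x ∘ e) (y ∘ e') = boxCost p a x y :=
  matchCost_comp_equiv p (fun j => scaleEmb a (x j)) (fun j => scaleEmb a (y j)) e e'

theorem boxCost_sum_le (p : ℝ) (a : Fin d → ℝ) (x y : κ ⊕ κ' → Fin d → ℝ) :
    boxCost p a x y ≤ boxCost p a (x ∘ Sum.inl) (y ∘ Sum.inl) +
      boxCost p a (x ∘ Sum.inr) (y ∘ Sum.inr) :=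
  matchCost_sum_le p (fun j => scaleEmb a (x j)) (fun j => scaleEmb a (y j))

theorem boxCost_one_sub {p : ℝ} (hp : 0 ≤ p) (a : Fin d → ℝ) (x y : κ → Fin d → ℝ) :
    boxCost p a (fun j => 1 - x j) (fun j => 1 - y j) = boxCost p a x y := by
  have key : ∀ x y : Fin d → ℝ, edist (scaleEmb a (1 - x)) (scaleEmb a (1 - y)) ≤
      edist (scaleEmb a x) (scaleEmb a y) := fun x y => edist_scaleEmb_le fun i => by
    rw [← mul_sub, ← mul_sub, abs_mul, abs_mul]
    simp [abs_sub_comm]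
  refine le_antisymm (matchCost_mono hp fun j k => key _ _) (matchCost_mono hp fun j k => ?_)
  simpa using key (1 - x j) (1 - y k)

/-- The law of a uniform point of the unit cube. -/
noncomputable def cubeMeasure (d : ℕ) : Measure (Fin d → ℝ) :=
  Measure.pi fun _ => volume.restrict (Set.Icc (0 : ℝ) 1)

instance : IsProbabilityMeasure (volume.restrict (Set.Icc (0 : ℝ) 1)) := ⟨by simp⟩

instance (d : ℕ) : IsProbabilityMeasure (cubeMeasure d) := by
  unfold cubeMeasure; infer_instance

theorem ae_cubeMeasure_mem (d : ℕ) :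
    ∀ᵐ x ∂cubeMeasure d, ∀ i, x i ∈ Set.Icc (0 : ℝ) 1 := by
  rw [ae_all_iff]
  intro i
  exact Measure.tendsto_eval_ae_ae.eventually (ae_restrict_mem measurableSet_Icc)

/-- The law of a family of independent uniform points of the unit cube. -/
noncomputable def iidCube (κ : Type*) [Fintype κ] (d : ℕ) : Measure (κ → Fin d → ℝ) :=
  Measure.pi fun _ => cubeMeasure d

instance : IsProbabilityMeasure (iidCube κ d) := by
  unfold iidCube; infer_instance

theorem ae_iidCube_mem : ∀ᵐ x ∂iidCube κ d, ∀ j i, x j i ∈ Set.Icc (0 : ℝ) 1 := by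
  rw [ae_all_iff]
  intro j
  exact (Measure.tendsto_eval_ae_ae (μ := fun _ : κ => cubeMeasure d)).eventually
    (ae_cubeMeasure_mem d)

theorem measurePreserving_comp_equiv (e : κ' ≃ κ) :
    MeasurePreserving (fun x : κ → Fin d → ℝ => x ∘ e) (iidCube κ d) (iidCube κ' d) :=
  measurePreserving_arrowCongr' (fun _ => cubeMeasure d) (fun _ => cubeMeasure d) e.symm
    (MeasurableEquiv.refl _) (fun _ => .id _)

theorem measurePreserving_one_sub_cubeMeasure :
    MeasurePreserving (fun x : Fin d → ℝ => 1 - x) (cubeMeasure d) (cubeMeasure d) := by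
  refine measurePreserving_pi (fun _ : Fin d => volume.restrict (Set.Icc (0 : ℝ) 1))
    (fun _ => volume.restrict (Set.Icc (0 : ℝ) 1)) (f := fun _ t => 1 - t) fun i => ?_
  have h := (Measure.measurePreserving_sub_left (volume : Measure ℝ) 1).restrict_preimage
    (s := Set.Icc (0 : ℝ) 1) measurableSet_Icc
  simpa using h

theorem measurePreserving_one_sub_iidCube :
    MeasurePreserving (fun (x : κ → Fin d → ℝ) j => 1 - x j) (iidCube κ d) (iidCube κ d) :=
  measurePreserving_pi (fun _ => cubeMeasure d) (fun _ => cubeMeasure d)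
    fun _ => measurePreserving_one_sub_cubeMeasure

/-- The expected matching cost of two independent families of uniform points in a box. -/
noncomputable def expCost (κ : Type*) [Fintype κ] {d : ℕ} (p : ℝ) (a : Fin d → ℝ) : ℝ≥0∞ :=
  ∫⁻ x, ∫⁻ y, boxCost p a x y ∂iidCube κ d ∂iidCube κ d

theorem expCost_mono {p : ℝ} (hp : 0 ≤ p) {a b : Fin d → ℝ} (ha : ∀ i, 0 ≤ a i)
    (hab : ∀ i, a i ≤ b i) : expCost κ p a ≤ expCost κ p b := by
  refine lintegral_mono fun x => lintegral_mono fun y => matchCost_mono hp fun j k =>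
    edist_scaleEmb_le fun i => ?_
  rw [← mul_sub, ← mul_sub, abs_mul, abs_mul]
  refine mul_le_mul_of_nonneg_right ?_ (abs_nonneg _)
  rw [abs_of_nonneg (ha i)]
  exact (hab i).trans (le_abs_self _)

theorem expCost_smul {p : ℝ} (hp : 0 ≤ p) {t : ℝ} (ht : 0 < t) (a : Fin d → ℝ) :
    expCost κ p (t • a) = ENNReal.ofReal t ^ p * expCost κ p a := by
  unfold expCost boxCost
  simp_rw [scaleEmb_smul, matchCost_smul hp ht]
  have htop : ENNReal.ofReal t ^ p ≠ ∞ := ENNReal.rpow_ne_top_of_nonneg hp (by simp)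
  simp_rw [lintegral_const_mul' _ _ htop]

theorem expCost_le {p : ℝ} (hp : 0 ≤ p) {a : Fin d → ℝ} {K : ℝ} (ha : ∀ i, 0 ≤ a i)
    (hK : ∀ i, a i ≤ K) :
    expCost κ p a ≤ Fintype.card κ * ENNReal.ofReal (√d * K) ^ p := by
  unfold expCost
  calc _ ≤ ∫⁻ _x, ∫⁻ _y, Fintype.card κ * ENNReal.ofReal (√d * K) ^ p
        ∂iidCube κ d ∂iidCube κ d := by
        refine lintegral_mono_ae ?_
        filter_upwards [ae_iidCube_mem] with x hx
        refine lintegral_mono_ae ?_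
        filter_upwards [ae_iidCube_mem] with y hy
        exact matchCost_le_card_mul hp fun j k => edist_scaleEmb_le_of_mem ha hK (hx j) (hy k)
    _ = _ := by simp

end Boxes

/-! ### Central moments of the Beta law -/

section BetaLaw

theorem integral_deriv_eq_zero_of_boundary {G G' : ℝ → ℝ} (h : ∀ t, HasDerivAt G (G' t) t)
    (hG' : Continuous G') (h0 : G 0 = 0) (h1 : G 1 = 0) : ∫ t in (0 : ℝ)..1, G' t = 0 := by
  rw [intervalIntegral.integral_eq_sub_of_hasDerivAt (fun t _ => h t)
    (hG'.intervalIntegrable 0 1), h0, h1, sub_zero]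

theorem hasDerivAt_pow_mul_one_sub_pow (a b : ℕ) (t : ℝ) :
    HasDerivAt (fun t : ℝ => t ^ (a + 1) * (1 - t) ^ (b + 1))
      (((a : ℝ) + 1) * (t ^ a * (1 - t) ^ (b + 1)) - ((b : ℝ) + 1) * (t ^ (a + 1) * (1 - t) ^ b))
      t := by
  have h1 := (hasDerivAt_id t).pow (a + 1)
  have h2 := ((hasDerivAt_id t).const_sub 1).pow (b + 1)
  refine (h1.mul h2).congr_deriv ?_
  simp
  ring

theorem integral_pow_mul_one_sub_pow (a b : ℕ) :
    ∫ t in (0 : ℝ)..1, t ^ a * (1 - t) ^ b =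
      (a.factorial * b.factorial : ℝ) / (a + b + 1).factorial := by
  induction b generalizing a with
  | zero =>
    simp only [pow_zero, mul_one, integral_pow]
    rw [add_zero, Nat.factorial_succ]
    have := Nat.cast_ne_zero (R := ℝ).2 (Nat.factorial_ne_zero a)
    push_cast
    field_simp
    simp
  | succ b ih =>
    have h := integral_deriv_eq_zero_of_boundary (hasDerivAt_pow_mul_one_sub_pow a b)
      (by fun_prop) (by simp) (by simp)
    rw [intervalIntegral.integral_sub ((by fun_prop : Continuous _).intervalIntegrable _ _)
      ((by fun_prop : Continuous _).intervalIntegrable _ _), intervalIntegral.integral_const_mul,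
      intervalIntegral.integral_const_mul, ih (a + 1)] at h
    have e : a + 1 + b + 1 = a + (b + 1) + 1 := by ring
    rw [e, Nat.factorial_succ a, sub_eq_zero] at h
    have ha : (a : ℝ) + 1 ≠ 0 := by positivity
    rw [Nat.factorial_succ b]
    apply mul_left_cancel₀ ha
    rw [h]; push_cast; ring

/-- Integrate the derivative of t^(a+1)·(1-t)^(b+1)·(t-μ)^(2k+1), which vanishes at both ends. As μ
is the mean, this trades two powers of t - μ for a factor t(1-t)·(2k+1)/(a+b+2), and t(1-t) ≤ 1/4.
-/
theorem integral_central_moment_succ_le (a b k : ℕ) :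
    ∫ t in (0 : ℝ)..1, (t - (a + 1) / (a + b + 2)) ^ (2 * (k + 1)) * (t ^ a * (1 - t) ^ b) ≤
      (2 * k + 1) / 4 / (a + b + 2) *
        ∫ t in (0 : ℝ)..1, (t - (a + 1) / (a + b + 2)) ^ (2 * k) * (t ^ a * (1 - t) ^ b) := by
  set μ : ℝ := (a + 1) / (a + b + 2) with hμ
  have hs : (0 : ℝ) < a + b + 2 := by positivity
  have hμs : (a : ℝ) + 1 = μ * (a + b + 2) := by rw [hμ]; field_simp
  clear_value μ
  have hder : ∀ t : ℝ, HasDerivAt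
      (fun t : ℝ => t ^ (a + 1) * (1 - t) ^ (b + 1) * (t - μ) ^ (2 * k + 1))
      ((2 * k + 1) * ((t - μ) ^ (2 * k) * (t ^ (a + 1) * (1 - t) ^ (b + 1))) -
        (a + b + 2) * ((t - μ) ^ (2 * (k + 1)) * (t ^ a * (1 - t) ^ b))) t := by
    intro t
    have h1 := hasDerivAt_pow_mul_one_sub_pow a b t
    have h2 := ((hasDerivAt_id t).sub_const μ).pow (2 * k + 1)
    refine (h1.mul h2).congr_deriv ?_
    simp only [id, Nat.add_sub_cancel, mul_one, Pi.pow_apply]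
    push_cast
    linear_combination (t ^ a * (1 - t) ^ b * (t - μ) ^ (2 * k + 1)) * hμs
  have h := integral_deriv_eq_zero_of_boundary hder (by fun_prop) (by simp) (by simp)
  rw [intervalIntegral.integral_sub ((by fun_prop : Continuous _).intervalIntegrable _ _)
    ((by fun_prop : Continuous _).intervalIntegrable _ _), intervalIntegral.integral_const_mul,
    intervalIntegral.integral_const_mul, sub_eq_zero] at h
  have hle : ∫ t in (0 : ℝ)..1, (t - μ) ^ (2 * k) * (t ^ (a + 1) * (1 - t) ^ (b + 1)) ≤
      ∫ t in (0 : ℝ)..1, 1 / 4 * ((t - μ) ^ (2 * k) * (t ^ a * (1 - t) ^ b)) := by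
    refine intervalIntegral.integral_mono_on zero_le_one
      ((by fun_prop : Continuous _).intervalIntegrable _ _)
      ((by fun_prop : Continuous _).intervalIntegrable _ _) fun t ht => ?_
    have h1 : 0 ≤ (t - μ) ^ (2 * k) := (even_two_mul k).pow_nonneg _
    have h2 : 0 ≤ t ^ a * (1 - t) ^ b :=
      mul_nonneg (pow_nonneg ht.1 _) (pow_nonneg (by linarith [ht.2]) _)
    have h3 : t * (1 - t) ≤ 1 / 4 := by nlinarith [sq_nonneg (t - 1 / 2)]
    calc _ = t * (1 - t) * ((t - μ) ^ (2 * k) * (t ^ a * (1 - t) ^ b)) := by ring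
      _ ≤ _ := mul_le_mul_of_nonneg_right h3 (mul_nonneg h1 h2)
  rw [intervalIntegral.integral_const_mul] at hle
  apply le_of_mul_le_mul_left _ hs
  rw [← h]
  have hk : (0 : ℝ) ≤ 2 * k + 1 := by positivity
  calc _ ≤ (2 * k + 1 : ℝ) *
        (1 / 4 * ∫ t in (0 : ℝ)..1, (t - μ) ^ (2 * k) * (t ^ a * (1 - t) ^ b)) :=
        mul_le_mul_of_nonneg_left hle hk
    _ = _ := by field_simp

theorem integral_central_moment_le (a b k : ℕ) :
    ∫ t in (0 : ℝ)..1, (t - (a + 1) / (a + b + 2)) ^ (2 * k) * (t ^ a * (1 - t) ^ b) ≤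
      (∏ j ∈ Finset.range k, ((2 * j + 1) / 4 : ℝ)) * ((a + b + 2 : ℝ)⁻¹) ^ k *
        ∫ t in (0 : ℝ)..1, t ^ a * (1 - t) ^ b := by
  induction k with
  | zero => simp
  | succ k ih =>
    have hk : (0 : ℝ) ≤ (2 * k + 1) / 4 / (a + b + 2) := by positivity
    refine (integral_central_moment_succ_le a b k).trans
      ((mul_le_mul_of_nonneg_left ih hk).trans (le_of_eq ?_))
    rw [Finset.prod_range_succ, pow_succ]
    ring

/-- The density of the Beta distribution with parameters `n₁ + 1` and `n₂`. -/
noncomputable def betaDensity (n₁ n₂ : ℕ) (t : ℝ) : ℝ :=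
  ((n₁ + n₂).choose n₁ * n₂ : ℝ) * (t ^ n₁ * (1 - t) ^ (n₂ - 1))

/-- The law of the `(n₁ + 1)`-st smallest among `n₁ + n₂` independent uniform points of `[0, 1]`. -/
noncomputable def betaLaw (n₁ n₂ : ℕ) : Measure ℝ :=
  (volume.restrict (Set.Ioo 0 1)).withDensity fun t => ENNReal.ofReal (betaDensity n₁ n₂ t)

@[fun_prop]
theorem continuous_betaDensity (n₁ n₂ : ℕ) : Continuous (betaDensity n₁ n₂) := by
  unfold betaDensity; fun_prop

theorem betaDensity_nonneg (n₁ n₂ : ℕ) {t : ℝ} (ht : t ∈ Set.Ioo (0 : ℝ) 1) :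
    0 ≤ betaDensity n₁ n₂ t := by
  have h1 := ht.1.le
  have h2 : 0 ≤ 1 - t := by linarith [ht.2]
  unfold betaDensity; positivity

theorem lintegral_betaLaw (n₁ n₂ : ℕ) {f : ℝ → ℝ≥0∞} (hf : Measurable f) :
    ∫⁻ t, f t ∂betaLaw n₁ n₂ =
      ∫⁻ t in Set.Ioo (0 : ℝ) 1, ENNReal.ofReal (betaDensity n₁ n₂ t) * f t := by
  unfold betaLaw
  rw [lintegral_withDensity_eq_lintegral_mul _
    (by have := continuous_betaDensity n₁ n₂; fun_prop) hf]
  rfl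

theorem lintegral_betaLaw_ofReal (n₁ n₂ : ℕ) {f : ℝ → ℝ} (hf : Continuous f) (hf0 : ∀ t, 0 ≤ f t) :
    ∫⁻ t, ENNReal.ofReal (f t) ∂betaLaw n₁ n₂ =
      ENNReal.ofReal (∫ t in (0 : ℝ)..1, betaDensity n₁ n₂ t * f t) := by
  rw [lintegral_betaLaw _ _ (by fun_prop), intervalIntegral.integral_of_le zero_le_one,
    integral_Ioc_eq_integral_Ioo, ofReal_integral_eq_lintegral_ofReal]
  · refine setLIntegral_congr_fun measurableSet_Ioo fun t ht => ?_
    exact (ENNReal.ofReal_mul (betaDensity_nonneg n₁ n₂ ht)).symm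
  · exact ((by fun_prop : Continuous fun t => betaDensity n₁ n₂ t * f t).integrableOn_Icc
      (a := 0) (b := 1)).mono_set Set.Ioo_subset_Icc_self
  · filter_upwards [ae_restrict_mem measurableSet_Ioo] with t ht
    exact mul_nonneg (betaDensity_nonneg n₁ n₂ ht) (hf0 t)

theorem integral_betaDensity (n₁ : ℕ) {n₂ : ℕ} (h₂ : 1 ≤ n₂) :
    ((n₁ + n₂).choose n₁ * n₂ : ℝ) * ∫ t in (0 : ℝ)..1, t ^ n₁ * (1 - t) ^ (n₂ - 1) = 1 := by
  obtain ⟨b, rfl⟩ : ∃ b, n₂ = b + 1 := ⟨n₂ - 1, by omega⟩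
  rw [Nat.add_sub_cancel, integral_pow_mul_one_sub_pow]
  have h := Nat.add_choose_mul_factorial_mul_factorial n₁ (b + 1)
  rw [← Nat.choose_symm_add] at h
  have h' : ((n₁ + (b + 1)).choose n₁ : ℝ) * n₁.factorial * (b + 1).factorial =
    (n₁ + (b + 1)).factorial := by exact_mod_cast h
  have h0 : ((n₁ + b + 1).factorial : ℝ) ≠ 0 := Nat.cast_ne_zero.2 (Nat.factorial_ne_zero _)
  rw [mul_div_assoc', div_eq_one_iff_eq h0, ← add_assoc] 
  rw [← add_assoc, Nat.factorial_succ b] at h'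
  rw [← h']; push_cast; ring

theorem isProbabilityMeasure_betaLaw (n₁ : ℕ) {n₂ : ℕ} (h₂ : 1 ≤ n₂) :
    IsProbabilityMeasure (betaLaw n₁ n₂) := by
  constructor
  have := lintegral_betaLaw_ofReal n₁ n₂ (f := fun _ => 1) continuous_const (by simp)
  simp only [ENNReal.ofReal_one, lintegral_one, mul_one] at this
  rw [this]
  unfold betaDensity
  rw [intervalIntegral.integral_const_mul, integral_betaDensity n₁ h₂, ENNReal.ofReal_one]

theorem eLpNorm'_betaLaw_le (k n₁ : ℕ) {n₂ : ℕ} (h₂ : 1 ≤ n₂) :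
    eLpNorm' (fun t : ℝ => t - ((n₁ : ℝ) + 1) / (n₁ + n₂ + 1)) (2 * (k + 1) : ℕ) (betaLaw n₁ n₂) ≤
      ENNReal.ofReal ((∏ j ∈ Finset.range (k + 1), ((2 * j + 1) / 4 : ℝ)) ^
        (1 / (2 * (k + 1) : ℕ) : ℝ) * ((n₁ + n₂ : ℕ) : ℝ) ^ (-(1 / 2) : ℝ)) := by
  obtain ⟨b, rfl⟩ : ∃ b, n₂ = b + 1 := ⟨n₂ - 1, by omega⟩
  set μ : ℝ := ((n₁ : ℝ) + 1) / (n₁ + (b + 1 : ℕ) + 1) with hμ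
  have hμ' : μ = ((n₁ : ℝ) + 1) / (n₁ + b + 2) := by rw [hμ]; push_cast; congr 1; ring
  set P := ∏ j ∈ Finset.range (k + 1), ((2 * j + 1) / 4 : ℝ) with hP
  have hP0 : 0 ≤ P := Finset.prod_nonneg fun j _ => by positivity
  have hn0 : (0 : ℝ) < (n₁ + (b + 1) : ℕ) := by positivity
  have hmom : ∫⁻ t, ‖t - μ‖ₑ ^ ((2 * (k + 1) : ℕ) : ℝ) ∂betaLaw n₁ (b + 1) ≤
      ENNReal.ofReal (P * (((n₁ + (b + 1) : ℕ) : ℝ)⁻¹) ^ (k + 1)) := by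
    have e : ∀ t : ℝ, ‖t - μ‖ₑ ^ ((2 * (k + 1) : ℕ) : ℝ) =
        ENNReal.ofReal ((t - μ) ^ (2 * (k + 1))) := by
      intro t
      rw [ENNReal.rpow_natCast, Real.enorm_eq_ofReal_abs, ← ENNReal.ofReal_pow (abs_nonneg _),
        (even_two_mul (k + 1)).pow_abs]
    simp_rw [e]
    rw [lintegral_betaLaw_ofReal _ _ (by fun_prop) fun t => (even_two_mul (k + 1)).pow_nonneg _]
    refine ENNReal.ofReal_le_ofReal ?_
    have h1 := integral_central_moment_le n₁ b (k + 1)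
    rw [← hμ', ← hP] at h1
    have hc : (0 : ℝ) ≤ ((n₁ + (b + 1)).choose n₁ * ((b + 1 : ℕ) : ℝ)) := by positivity
    have h3 := integral_betaDensity n₁ h₂
    rw [Nat.add_sub_cancel] at h3
    have e3 : ∀ t : ℝ, betaDensity n₁ (b + 1) t * (t - μ) ^ (2 * (k + 1)) =
        ((n₁ + (b + 1)).choose n₁ * ((b + 1 : ℕ) : ℝ)) *
          ((t - μ) ^ (2 * (k + 1)) * (t ^ n₁ * (1 - t) ^ b)) := by
      intro t; unfold betaDensity; rw [Nat.add_sub_cancel]; ring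
    simp_rw [e3]
    rw [intervalIntegral.integral_const_mul]
    refine (mul_le_mul_of_nonneg_left h1 hc).trans ?_
    calc _ = P * ((n₁ + b + 2 : ℝ)⁻¹) ^ (k + 1) *
          (((n₁ + (b + 1)).choose n₁ * ((b + 1 : ℕ) : ℝ)) *
            ∫ t in (0 : ℝ)..1, t ^ n₁ * (1 - t) ^ b) := by ring
      _ = P * ((n₁ + b + 2 : ℝ)⁻¹) ^ (k + 1) := by rw [h3, mul_one]
      _ ≤ _ := by
        refine mul_le_mul_of_nonneg_left (pow_le_pow_left₀ (by positivity) ?_ _) hP0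
        refine inv_anti₀ hn0 ?_
        push_cast; linarith
  unfold eLpNorm'
  refine (ENNReal.rpow_le_rpow hmom (by positivity)).trans (le_of_eq ?_)
  rw [ENNReal.ofReal_rpow_of_nonneg (by positivity) (by positivity),
    Real.mul_rpow hP0 (by positivity), inv_pow, Real.inv_rpow (by positivity),
    ← Real.rpow_natCast _ (k + 1), ← Real.rpow_mul hn0.le, ← Real.rpow_neg hn0.le]
  congr 4
  push_cast
  field_simp

/-- The L^p norm is dominated by that of an even exponent 2(k+1) ≥ p, and the centre is moved from
the mean to n₁/(n₁+n₂). -/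
theorem exists_eLpNorm'_betaLaw_le {p : ℝ} (hp : 1 ≤ p) : ∃ C : ℝ, 0 ≤ C ∧
    ∀ n₁ n₂ : ℕ, 1 ≤ n₁ → 1 ≤ n₂ →
      eLpNorm' (fun t : ℝ => t - (n₁ : ℝ) / (n₁ + n₂ : ℕ)) p (betaLaw n₁ n₂) ≤
        ENNReal.ofReal (C * ((n₁ + n₂ : ℕ) : ℝ) ^ (-(1 / 2) : ℝ)) := by
  obtain ⟨k, hk⟩ := exists_nat_ge p
  have hp0 : 0 < p := by linarith
  set P := ∏ j ∈ Finset.range (k + 1), ((2 * j + 1) / 4 : ℝ) with hP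
  have hP0 : 0 ≤ P := Finset.prod_nonneg fun j _ => by positivity
  refine ⟨P ^ (1 / (2 * (k + 1) : ℕ) : ℝ) + 1, by positivity, fun n₁ n₂ h₁ h₂ => ?_⟩
  have := isProbabilityMeasure_betaLaw n₁ h₂
  have hn0 : (0 : ℝ) < (n₁ + n₂ : ℕ) := by positivity
  set μ : ℝ := ((n₁ : ℝ) + 1) / (n₁ + n₂ + 1) with hμ
  -- The two centres differ by at most 1/n ≤ n^(-1/2); this is the summand 1 in the constant.
  have hdiff : |μ - (n₁ : ℝ) / (n₁ + n₂ : ℕ)| ≤ ((n₁ + n₂ : ℕ) : ℝ) ^ (-(1 / 2) : ℝ) := by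
    have h1 : (1 : ℝ) ≤ (n₁ + n₂ : ℕ) := by exact_mod_cast (by omega : 1 ≤ n₁ + n₂)
    have e : μ - (n₁ : ℝ) / (n₁ + n₂ : ℕ) = n₂ / ((n₁ + n₂ : ℕ) * (n₁ + n₂ + 1)) := by
      rw [hμ]; push_cast at hn0 ⊢; field_simp; ring
    rw [e, abs_of_nonneg (by positivity)]
    calc (n₂ : ℝ) / ((n₁ + n₂ : ℕ) * (n₁ + n₂ + 1)) ≤ ((n₁ + n₂ : ℕ) : ℝ)⁻¹ := by
          rw [← one_div, div_le_div_iff₀ (by positivity) hn0]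
          nlinarith [(Nat.cast_nonneg n₁ : (0 : ℝ) ≤ n₁)]
      _ = ((n₁ + n₂ : ℕ) : ℝ) ^ (-1 : ℝ) := (Real.rpow_neg_one _).symm
      _ ≤ _ := Real.rpow_le_rpow_of_exponent_le h1 (by norm_num)
  have hfun : (fun t : ℝ => t - (n₁ : ℝ) / (n₁ + n₂ : ℕ)) =
      (fun t : ℝ => t - μ) + fun _ => μ - (n₁ : ℝ) / (n₁ + n₂ : ℕ) := by
    funext t; simp
  rw [hfun, add_mul, one_mul, ENNReal.ofReal_add (by positivity) (by positivity)]
  refine (eLpNorm'_add_le (by fun_prop) (by fun_prop) hp).trans (add_le_add ?_ ?_)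
  · refine (eLpNorm'_le_eLpNorm'_of_exponent_le hp0 (q := (2 * (k + 1) : ℕ)) ?_ (betaLaw n₁ n₂)
      (by fun_prop)).trans (eLpNorm'_betaLaw_le k n₁ h₂)
    push_cast; linarith [(Nat.cast_nonneg k : (0 : ℝ) ≤ k)]
  · rw [eLpNorm'_const _ hp0]
    simp only [measure_univ, ENNReal.one_rpow, mul_one]
    rw [Real.enorm_eq_ofReal_abs]
    exact ENNReal.ofReal_le_ofReal hdiff

end BetaLaw

/-! ### Law of the lowest points of a sample -/

theorem Measure.pi_const_smul {ι : Type*} [Fintype ι] {α : ι → Type*}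
    [∀ i, MeasurableSpace (α i)] (μ : ∀ i, Measure (α i)) [∀ i, IsFiniteMeasure (μ i)]
    (c : ι → ℝ≥0∞) (hc : ∀ i, c i ≠ ∞) :
    Measure.pi (fun i => c i • μ i) = (∏ i, c i) • Measure.pi μ := by
  have : ∀ i, IsFiniteMeasure (c i • μ i) := fun i => (μ i).smul_finite (hc i)
  refine Measure.pi_eq fun s _ => ?_
  simp [Finset.prod_mul_distrib]

theorem restrict_Icc_restrict_Iic {t : ℝ} (ht0 : 0 < t) (ht1 : t ≤ 1) :
    (volume.restrict (Set.Icc (0 : ℝ) 1)).restrict (Set.Iic t) =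
      ENNReal.ofReal t • (volume.restrict (Set.Icc (0 : ℝ) 1)).map (t * ·) := by
  rw [Measure.restrict_restrict measurableSet_Iic]
  have h1 : Set.Icc (0 : ℝ) 1 = (t * ·) ⁻¹' Set.Icc 0 t := by
    ext x
    simp only [Set.mem_Icc, Set.mem_preimage]
    constructor
    · rintro ⟨h1, h2⟩; constructor <;> nlinarith
    · rintro ⟨h1, h2⟩; constructor <;> nlinarith
  have h2 : Set.Iic t ∩ Set.Icc (0 : ℝ) 1 = Set.Icc 0 t := by
    ext x
    simp only [Set.mem_inter_iff, Set.mem_Iic, Set.mem_Icc]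
    constructor
    · rintro ⟨h1, h2, h3⟩; exact ⟨h2, h1⟩
    · rintro ⟨h1, h2⟩; exact ⟨h2, h1, h2.trans ht1⟩
  rw [h2]
  conv_rhs => rw [h1]
  rw [← Measure.restrict_map (by fun_prop) measurableSet_Icc, Real.map_volume_mul_left ht0.ne',
    Measure.restrict_smul, smul_smul, ← ENNReal.ofReal_mul ht0.le, abs_of_pos (by positivity),
    mul_inv_cancel₀ ht0.ne', ENNReal.ofReal_one, one_smul]

section Blocks

variable {d : ℕ}

/-- The side lengths of the unit cube rescaled by `t` in the coordinate `i`. -/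
def axisScale (i : Fin d) (t : ℝ) : Fin d → ℝ := Function.update 1 i t

@[fun_prop]
theorem measurable_axisScale (i : Fin d) : Measurable (axisScale i) := measurable_update 1

theorem cubeMeasure_restrict (i : Fin d) {t : ℝ} (ht0 : 0 < t) (ht1 : t ≤ 1) :
    (cubeMeasure d).restrict {x | x i ≤ t} =
      ENNReal.ofReal t • (cubeMeasure d).map (fun x => axisScale i t * x) := by
  classical
  have hset : {x : Fin d → ℝ | x i ≤ t} =
      Set.univ.pi (Function.update (fun _ => Set.univ) i (Set.Iic t)) := by
    ext x
    simp only [Set.mem_ofPred_eq, Set.mem_univ_pi]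
    constructor
    · intro h j
      rcases eq_or_ne j i with rfl | hj
      · simpa using h
      · simp [Function.update_of_ne hj]
    · intro h; simpa using h i
  unfold cubeMeasure
  rw [hset, Measure.restrict_pi_pi]
  have hmap : (Measure.pi fun _ : Fin d => volume.restrict (Set.Icc (0 : ℝ) 1)).map
      (fun x => axisScale i t * x) =
      Measure.pi fun j => (volume.restrict (Set.Icc (0 : ℝ) 1)).map
        (axisScale i t j * ·) :=
    Measure.pi_map_pi fun j => (measurable_const_mul _).aemeasurable
  rw [hmap]
  have hprob : ∀ j, IsProbabilityMeasure ((volume.restrict (Set.Icc (0 : ℝ) 1)).map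
      (axisScale i t j * ·)) := fun j =>
    Measure.isProbabilityMeasure_map (by fun_prop)
  have hprod : ENNReal.ofReal t =
      ∏ j, Function.update (1 : Fin d → ℝ≥0∞) i (ENNReal.ofReal t) j := by
    rw [Finset.prod_update_of_mem (Finset.mem_univ i)]; simp
  rw [hprod, ← Measure.pi_const_smul _ _ fun j => ?_]
  · congr 1
    funext j
    rcases eq_or_ne j i with rfl | hj
    · simpa [axisScale] using restrict_Icc_restrict_Iic ht0 ht1
    · simp [axisScale, Function.update_of_ne hj]
  · rcases eq_or_ne j i with rfl | hj
    · simp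
    · simp [Function.update_of_ne hj]

/-- Points conditioned to lie below t are i.i.d. uniform in the shrunken box; the event has
probability t to the number of points. -/
theorem iidCube_restrict {κ : Type*} [Fintype κ] (i : Fin d) {t : ℝ} (ht0 : 0 < t) (ht1 : t ≤ 1) :
    (iidCube κ d).restrict {u | ∀ j, u j i ≤ t} = ENNReal.ofReal t ^ Fintype.card κ •
      (iidCube κ d).map (fun u j => axisScale i t * u j) := by
  have hset : {u : κ → Fin d → ℝ | ∀ j, u j i ≤ t} = Set.univ.pi fun _ => {x | x i ≤ t} := by
    ext u; simp
  unfold iidCube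
  have hmap : (Measure.pi fun _ : κ => cubeMeasure d).map
      (fun u j => axisScale i t * u j) =
      Measure.pi fun _ : κ => (cubeMeasure d).map (fun x => axisScale i t * x) :=
    Measure.pi_map_pi fun j => by fun_prop
  have hprob : IsProbabilityMeasure ((cubeMeasure d).map (fun x => axisScale i t * x)) :=
    Measure.isProbabilityMeasure_map (by fun_prop)
  rw [hset, Measure.restrict_pi_pi, hmap]
  simp_rw [cubeMeasure_restrict i ht0 ht1]
  rw [Measure.pi_const_smul _ _ fun _ => by simp]
  simp

/-- Configurations whose left block lies below the right block in the coordinate `i`. -/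
def orderedBlocks (i : Fin d) (κ κ' : Type*) : Set (κ ⊕ κ' → Fin d → ℝ) :=
  {x | ∀ j k, x (Sum.inl j) i ≤ x (Sum.inr k) i}

theorem measurableSet_orderedBlocks (i : Fin d) (κ κ' : Type*) [Countable κ] [Countable κ'] :
    MeasurableSet (orderedBlocks i κ κ') := by
  unfold orderedBlocks
  simp only [Set.ofPred_forall]
  exact .iInter fun j => .iInter fun k => measurableSet_le (by fun_prop) (by fun_prop)

theorem lintegral_orderedBlocks {κ κ' : Type*} [Fintype κ] [Fintype κ'] (i : Fin d)
    {G : (κ → Fin d → ℝ) → ℝ≥0∞} (hG : Measurable G) :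
    ∫⁻ x in orderedBlocks i κ κ', G (x ∘ Sum.inl) ∂iidCube (κ ⊕ κ') d =
      ∫⁻ u, G u * iidCube κ' d {v | ∀ j k, u j i ≤ v k i} ∂iidCube κ d := by
  have hmp : MeasurePreserving
      (MeasurableEquiv.sumPiEquivProdPi fun _ : κ ⊕ κ' => Fin d → ℝ) (iidCube (κ ⊕ κ') d)
      ((iidCube κ d).prod (iidCube κ' d)) :=
    measurePreserving_sumPiEquivProdPi fun _ : κ ⊕ κ' => cubeMeasure d
  set B : Set ((κ → Fin d → ℝ) × (κ' → Fin d → ℝ)) := {z | ∀ j k, z.1 j i ≤ z.2 k i} with hB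
  have hBm : MeasurableSet B := by
    rw [hB]
    simp only [Set.ofPred_forall]
    exact .iInter fun j => .iInter fun k => measurableSet_le (by fun_prop) (by fun_prop)
  have hf : Measurable (B.indicator fun z => G z.1) := (hG.comp measurable_fst).indicator hBm
  rw [← lintegral_indicator (measurableSet_orderedBlocks i κ κ')]
  have h1 : ∫⁻ x, (orderedBlocks i κ κ').indicator (fun x => G (x ∘ Sum.inl)) x ∂iidCube (κ ⊕ κ') d =
      ∫⁻ z, B.indicator (fun z => G z.1) z ∂(iidCube κ d).prod (iidCube κ' d) := by
    rw [← hmp.lintegral_comp hf]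
    rfl
  rw [h1, lintegral_prod _ hf.aemeasurable]
  refine lintegral_congr fun u => ?_
  have hm : MeasurableSet {v : κ' → Fin d → ℝ | ∀ j k, u j i ≤ v k i} := by
    simp only [Set.ofPred_forall]
    exact .iInter fun j => .iInter fun k => measurableSet_le (by fun_prop) (by fun_prop)
  have h2 : ∀ v, B.indicator (fun z => G z.1) (u, v) =
      {v : κ' → Fin d → ℝ | ∀ j k, u j i ≤ v k i}.indicator (fun _ => G u) v := fun v => rfl
  simp_rw [h2]
  rw [lintegral_indicator_const hm]

theorem cubeMeasure_le_coord (i : Fin d) {s : ℝ} (hs : 0 ≤ s) :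
    cubeMeasure d {x | s ≤ x i} = ENNReal.ofReal (1 - s) := by
  have h := (measurePreserving_eval (fun _ : Fin d => volume.restrict (Set.Icc (0 : ℝ) 1)) i)
  have e : {x : Fin d → ℝ | s ≤ x i} = Function.eval i ⁻¹' Set.Ici s := rfl
  unfold cubeMeasure
  rw [e, h.measure_preimage measurableSet_Ici.nullMeasurableSet,
    Measure.restrict_apply measurableSet_Ici]
  have : Set.Ici s ∩ Set.Icc 0 1 = Set.Icc s 1 := by
    ext x; simp only [Set.mem_inter_iff, Set.mem_Ici, Set.mem_Icc]
    constructor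
    · rintro ⟨h1, -, h3⟩; exact ⟨h1, h3⟩
    · rintro ⟨h1, h2⟩; exact ⟨h1, hs.trans h1, h2⟩
  rw [this, Real.volume_Icc]

theorem integral_one_sub_pow (b : ℕ) (s : ℝ) :
    ∫ t in s..1, ((b : ℝ) + 1) * (1 - t) ^ b = (1 - s) ^ (b + 1) := by
  have hder : ∀ t : ℝ, HasDerivAt (fun t : ℝ => -(1 - t) ^ (b + 1)) (((b : ℝ) + 1) * (1 - t) ^ b) t := by
    intro t
    refine (((hasDerivAt_id t).const_sub 1).pow (b + 1)).neg.congr_deriv ?_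
    simp
  rw [intervalIntegral.integral_eq_sub_of_hasDerivAt (fun t _ => hder t)
    ((by fun_prop : Continuous _).intervalIntegrable _ _)]
  simp

/-- If s is the largest coordinate of u, the left side is (1-s)^n₂, the integral over (s, 1) of
n₂(1-t)^(n₂-1), the density of the lowest point of the upper block. This introduces t as an
integration variable. -/
theorem measure_above_le {n₁ n₂ : ℕ} (h₁ : 1 ≤ n₁) (h₂ : 1 ≤ n₂) (i : Fin d)
    {u : Fin n₁ → Fin d → ℝ} (hu : ∀ j i, u j i ∈ Set.Icc (0 : ℝ) 1) :
    iidCube (Fin n₂) d {v | ∀ j k, u j i ≤ v k i} ≤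
      ∫⁻ t in Set.Ioo (0 : ℝ) 1, ENNReal.ofReal (n₂ * (1 - t) ^ (n₂ - 1)) *
        {t : ℝ | ∀ j, u j i ≤ t}.indicator 1 t := by
  obtain ⟨b, rfl⟩ : ∃ b, n₂ = b + 1 := ⟨n₂ - 1, by omega⟩
  have : Nonempty (Fin n₁) := ⟨⟨0, by omega⟩⟩
  obtain ⟨j₀, hj₀⟩ := Finite.exists_max fun j => u j i
  set s := u j₀ i with hs
  have hs0 : 0 ≤ s := (hu j₀ i).1
  have hs1 : s ≤ 1 := (hu j₀ i).2
  have hset : {v : Fin (b + 1) → Fin d → ℝ | ∀ j k, u j i ≤ v k i} =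
      Set.univ.pi fun _ => {x | s ≤ x i} := by
    ext v
    simp only [Set.mem_ofPred_eq, Set.mem_univ_pi]
    exact ⟨fun h k => h j₀ k, fun h j k => (hj₀ j).trans (h k)⟩
  have hLHS : iidCube (Fin (b + 1)) d {v | ∀ j k, u j i ≤ v k i} =
      ENNReal.ofReal ((1 - s) ^ (b + 1)) := by
    unfold iidCube
    rw [hset, Measure.pi_pi]
    simp [cubeMeasure_le_coord i hs0, ENNReal.ofReal_pow (sub_nonneg.2 hs1)]
  rw [hLHS, ← integral_one_sub_pow, intervalIntegral.integral_of_le hs1,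
    integral_Ioc_eq_integral_Ioo, ofReal_integral_eq_lintegral_ofReal]
  · calc ∫⁻ t in Set.Ioo s 1, ENNReal.ofReal (((b : ℝ) + 1) * (1 - t) ^ b)
        = ∫⁻ t in Set.Ioo s 1, ENNReal.ofReal ((b + 1 : ℕ) * (1 - t) ^ (b + 1 - 1)) *
          {t : ℝ | ∀ j, u j i ≤ t}.indicator 1 t := by
          refine setLIntegral_congr_fun measurableSet_Ioo fun t ht => ?_
          have : t ∈ {t : ℝ | ∀ j, u j i ≤ t} := fun j => (hj₀ j).trans ht.1.le
          simp [Set.indicator_of_mem this]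
      _ ≤ _ := lintegral_mono_set (Set.Ioo_subset_Ioo_left hs0)
  · exact ((by fun_prop : Continuous fun t : ℝ => ((b : ℝ) + 1) * (1 - t) ^ b).integrableOn_Icc
      (a := s) (b := 1)).mono_set Set.Ioo_subset_Icc_self
  · filter_upwards [ae_restrict_mem measurableSet_Ioo] with t ht
    have : 0 ≤ 1 - t := by linarith [ht.2]
    simp only [Pi.zero_apply]; positivity

/-- The lowest `n₁` among `n₁ + n₂` uniform points are, given the position of the next one,
independent and uniform below it. -/
theorem choose_mul_lintegral_lower_le {n₁ n₂ : ℕ} (h₁ : 1 ≤ n₁) (h₂ : 1 ≤ n₂) (i : Fin d)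
    {G : (Fin n₁ → Fin d → ℝ) → ℝ≥0∞} (hG : Measurable G) :
    (n₁ + n₂).choose n₁ * ∫⁻ x in orderedBlocks i (Fin n₁) (Fin n₂), G (x ∘ Sum.inl)
        ∂iidCube (Fin n₁ ⊕ Fin n₂) d ≤
      ∫⁻ t, ∫⁻ u, G (fun j => axisScale i t * u j) ∂iidCube (Fin n₁) d ∂betaLaw n₁ n₂ := by
  have hupd : Measurable fun t : ℝ => axisScale i t := measurable_axisScale i
  have hscale : Measurable fun z : ℝ × (Fin n₁ → Fin d → ℝ) =>
      fun j => axisScale i z.1 * z.2 j := by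
    refine measurable_pi_lambda _ fun j => ?_
    exact (hupd.comp measurable_fst).mul (by fun_prop)
  have hmeas : Measurable fun t : ℝ =>
      ∫⁻ u, G (fun j => axisScale i t * u j) ∂iidCube (Fin n₁) d :=
    (hG.comp hscale).lintegral_prod_right'
  set w : ℝ → ℝ≥0∞ := fun t => ENNReal.ofReal (n₂ * (1 - t) ^ (n₂ - 1)) with hw
  have hwm : Measurable w := by fun_prop
  set D : Set (ℝ × (Fin n₁ → Fin d → ℝ)) := {z | ∀ j, z.2 j i ≤ z.1} with hD
  have hDm : MeasurableSet D := by
    rw [hD]; simp only [Set.ofPred_forall]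
    exact .iInter fun j => measurableSet_le (by fun_prop) (by fun_prop)
  rw [lintegral_orderedBlocks i hG, lintegral_betaLaw _ _ hmeas]
  -- For fixed t the lower block contributes t^n₁ times the rescaled i.i.d. law; with the binomial
  -- coefficient and the weight `w` this is the Beta density.
  have hR : ∫⁻ t in Set.Ioo (0 : ℝ) 1, ENNReal.ofReal (betaDensity n₁ n₂ t) *
      ∫⁻ u, G (fun j => axisScale i t * u j) ∂iidCube (Fin n₁) d =
      ∫⁻ t in Set.Ioo (0 : ℝ) 1, (n₁ + n₂).choose n₁ *
        ∫⁻ u, w t * (G u * D.indicator 1 (t, u)) ∂iidCube (Fin n₁) d := by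
    refine setLIntegral_congr_fun measurableSet_Ioo fun t ht => ?_
    have hsm : MeasurableSet {u : Fin n₁ → Fin d → ℝ | ∀ j, u j i ≤ t} := by
      simp only [Set.ofPred_forall]
      exact .iInter fun j => measurableSet_le (by fun_prop) (by fun_prop)
    have hu : Measurable fun (u : Fin n₁ → Fin d → ℝ) j => axisScale i t * u j := by
      fun_prop
    have e1 : ∫⁻ u, G u * D.indicator 1 (t, u) ∂iidCube (Fin n₁) d =
        ENNReal.ofReal t ^ n₁ *
          ∫⁻ u, G (fun j => axisScale i t * u j) ∂iidCube (Fin n₁) d := by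
      have : ∀ u, G u * D.indicator 1 (t, u) =
          {u : Fin n₁ → Fin d → ℝ | ∀ j, u j i ≤ t}.indicator G u := by
        intro u
        by_cases h : ∀ j, u j i ≤ t
        · have h' : (t, u) ∈ D := h
          rw [Set.indicator_of_mem h', Set.indicator_of_mem (by exact h)]; simp
        · have h' : (t, u) ∉ D := h
          rw [Set.indicator_of_notMem h', Set.indicator_of_notMem (by exact h)]; simp
      simp_rw [this]
      rw [lintegral_indicator hsm, iidCube_restrict i ht.1 ht.2.le, lintegral_smul_measure,
        lintegral_map hG hu]
      simp
    have e2 : ENNReal.ofReal (betaDensity n₁ n₂ t) =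
        (n₁ + n₂).choose n₁ * w t * ENNReal.ofReal t ^ n₁ := by
      have h0 : 0 ≤ 1 - t := by linarith [ht.2]
      rw [hw, ← ENNReal.ofReal_pow ht.1.le, ← ENNReal.ofReal_natCast (Nat.choose _ _),
        ← ENNReal.ofReal_mul (by positivity), ← ENNReal.ofReal_mul (by positivity)]
      congr 1
      unfold betaDensity; ring
    have hm : Measurable fun u => G u * D.indicator 1 (t, u) :=
      hG.mul ((measurable_one.indicator hDm).comp measurable_prodMk_left)
    rw [lintegral_const_mul _ hm, e1, e2]
    ring
  have hjoint : Measurable fun z : ℝ × (Fin n₁ → Fin d → ℝ) =>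
      w z.1 * (G z.2 * D.indicator 1 z) :=
    (hwm.comp measurable_fst).mul ((hG.comp measurable_snd).mul (measurable_one.indicator hDm))
  -- Tonelli moves the t integral inside, where it can be compared with `measure_above_le` for each
  -- u.
  rw [hR, lintegral_const_mul _ hjoint.lintegral_prod_right',
    lintegral_lintegral_swap hjoint.aemeasurable]
  refine mul_le_mul_right ?_ _
  refine lintegral_mono_ae ?_
  filter_upwards [ae_iidCube_mem] with u hu
  refine (mul_le_mul_right (measure_above_le h₁ h₂ i hu) (G u)).trans (le_of_eq ?_)
  rw [← lintegral_const_mul]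
  · refine lintegral_congr fun t => ?_
    have : D.indicator (1 : ℝ × (Fin n₁ → Fin d → ℝ) → ℝ≥0∞) (t, u) = {t : ℝ | ∀ j, u j i ≤ t}.indicator 1 t := rfl
    rw [this, hw]; ring
  · refine hwm.mul (measurable_one.indicator ?_)
    simp only [Set.ofPred_forall]
    exact .iInter fun j => measurableSet_le (by fun_prop) (by fun_prop)

end Blocks

/-! ### The splitting inequality -/

section Split

variable {d : ℕ}

/-- The cardinality condition sits inside the existential so that `choose` yields an equivalence for
every S; other cardinalities get an arbitrary one. -/
theorem exists_equiv_of_card {n₁ n₂ : ℕ} (S : Finset (Fin (n₁ + n₂))) :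
    ∃ e : Fin n₁ ⊕ Fin n₂ ≃ Fin (n₁ + n₂), S.card = n₁ →
      (∀ j, e (Sum.inl j) ∈ S) ∧ ∀ k, e (Sum.inr k) ∉ S := by
  by_cases h : S.card = n₁
  · have h' : Sᶜ.card = n₂ := by rw [Finset.card_compl, h]; simp
    refine ⟨finSumEquivOfFinset h h', fun _ => ⟨fun j => ?_, fun k => ?_⟩⟩
    · rw [finSumEquivOfFinset_inl]; exact Finset.orderEmbOfFin_mem _ _ _
    · rw [finSumEquivOfFinset_inr]
      exact Finset.mem_compl.1 (Finset.orderEmbOfFin_mem _ _ _)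
  · exact ⟨finSumFinEquiv, fun h' => absurd h' h⟩

theorem exists_comp_mem_orderedBlocks {n₁ n₂ : ℕ} (i : Fin d)
    {e : Finset (Fin (n₁ + n₂)) → (Fin n₁ ⊕ Fin n₂ ≃ Fin (n₁ + n₂))}
    (he : ∀ S : Finset (Fin (n₁ + n₂)), S.card = n₁ →
      (∀ j, e S (Sum.inl j) ∈ S) ∧ ∀ k, e S (Sum.inr k) ∉ S)
    (x : Fin (n₁ + n₂) → Fin d → ℝ) :
    ∃ S ∈ Finset.powersetCard n₁ Finset.univ, x ∘ e S ∈ orderedBlocks i (Fin n₁) (Fin n₂) := by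
  set σ := Tuple.sort fun j => x j i
  have hmono : Monotone ((fun j => x j i) ∘ σ) := Tuple.monotone_sort _
  set S : Finset (Fin (n₁ + n₂)) := Finset.univ.filter fun j => (σ.symm j : ℕ) < n₁ with hS
  have hcard : S.card = n₁ := by
    have : S = (Finset.univ : Finset (Fin n₁)).map
        ((Fin.castAddEmb n₂).trans σ.toEmbedding) := by
      ext j
      simp only [hS, Finset.mem_filter, Finset.mem_univ, true_and, Finset.mem_map,
        Function.Embedding.trans_apply, Equiv.coe_toEmbedding]
      constructor
      · intro h
        refine ⟨⟨σ.symm j, h⟩, ?_⟩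
        rw [← Equiv.eq_symm_apply]; rfl
      · rintro ⟨k, rfl⟩
        simp
    rw [this]; simp
  refine ⟨S, by simp [hcard], fun j k => ?_⟩
  have h1 := (he S hcard).1 j
  have h2 := (he S hcard).2 k
  simp only [hS, Finset.mem_filter, Finset.mem_univ, true_and, not_lt] at h1 h2
  have h3 := hmono (a := σ.symm (e S (Sum.inl j))) (b := σ.symm (e S (Sum.inr k)))
    (Fin.le_def.2 (h1.le.trans h2))
  simpa using h3

/-- Integrals of symmetric functions are controlled by the configurations whose first `n₁` points
are the lowest ones. -/
theorem lintegral_le_choose_mul {n₁ n₂ : ℕ} (i : Fin d)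
    {F : (Fin (n₁ + n₂) → Fin d → ℝ) → ℝ≥0∞} {F' : (Fin n₁ ⊕ Fin n₂ → Fin d → ℝ) → ℝ≥0∞}
    (hF' : Measurable F') (hF : ∀ x (e : Fin n₁ ⊕ Fin n₂ ≃ Fin (n₁ + n₂)), F x = F' (x ∘ e)) :
    ∫⁻ x, F x ∂iidCube (Fin (n₁ + n₂)) d ≤
      (n₁ + n₂).choose n₁ * ∫⁻ x in orderedBlocks i (Fin n₁) (Fin n₂), F' x
        ∂iidCube (Fin n₁ ⊕ Fin n₂) d := by
  choose e he using exists_equiv_of_card (n₁ := n₁) (n₂ := n₂)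
  have hA := measurableSet_orderedBlocks i (Fin n₁) (Fin n₂)
  calc ∫⁻ x, F x ∂iidCube (Fin (n₁ + n₂)) d
      ≤ ∫⁻ x, ∑ S ∈ Finset.powersetCard n₁ Finset.univ,
          (orderedBlocks i (Fin n₁) (Fin n₂)).indicator F' (x ∘ e S)
          ∂iidCube (Fin (n₁ + n₂)) d := by
        -- Sorting provides at least one suitable S, and ties only add nonnegative terms, hence an
        -- inequality. By exchangeability all summands have the same integral.
        refine lintegral_mono fun x => ?_
        obtain ⟨S, hS, hx⟩ := exists_comp_mem_orderedBlocks i he x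
        rw [hF x (e S), ← Set.indicator_of_mem hx F']
        exact Finset.single_le_sum
          (f := fun S => (orderedBlocks i (Fin n₁) (Fin n₂)).indicator F' (x ∘ e S))
          (fun _ _ => zero_le) hS
    _ = ∑ S ∈ Finset.powersetCard n₁ Finset.univ, ∫⁻ x,
          (orderedBlocks i (Fin n₁) (Fin n₂)).indicator F' (x ∘ e S)
          ∂iidCube (Fin (n₁ + n₂)) d := by
        refine lintegral_finsetSum _ fun S _ => ?_
        exact (hF'.indicator hA).comp (measurePreserving_comp_equiv (e S)).measurable
    _ = ∑ S ∈ Finset.powersetCard n₁ (Finset.univ : Finset (Fin (n₁ + n₂))),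
          ∫⁻ x in orderedBlocks i (Fin n₁) (Fin n₂), F' x ∂iidCube (Fin n₁ ⊕ Fin n₂) d := by
        refine Finset.sum_congr rfl fun S _ => ?_
        rw [(measurePreserving_comp_equiv (e S)).lintegral_comp (hF'.indicator hA),
          lintegral_indicator hA]
    _ = _ := by simp

theorem lintegral_lintegral_le_choose_mul {n₁ n₂ : ℕ} (i : Fin d)
    {B : (Fin (n₁ + n₂) → Fin d → ℝ) → (Fin (n₁ + n₂) → Fin d → ℝ) → ℝ≥0∞}
    {B' : (Fin n₁ ⊕ Fin n₂ → Fin d → ℝ) × (Fin n₁ ⊕ Fin n₂ → Fin d → ℝ) → ℝ≥0∞}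
    (hB' : Measurable B')
    (hB : ∀ x y (e e' : Fin n₁ ⊕ Fin n₂ ≃ Fin (n₁ + n₂)), B x y = B' (x ∘ e, y ∘ e')) :
    ∫⁻ x, ∫⁻ y, B x y ∂iidCube (Fin (n₁ + n₂)) d ∂iidCube (Fin (n₁ + n₂)) d ≤
      (n₁ + n₂).choose n₁ * ∫⁻ x in orderedBlocks i (Fin n₁) (Fin n₂),
        (n₁ + n₂).choose n₁ * ∫⁻ y in orderedBlocks i (Fin n₁) (Fin n₂), B' (x, y)
          ∂iidCube (Fin n₁ ⊕ Fin n₂) d ∂iidCube (Fin n₁ ⊕ Fin n₂) d := by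
  set e₀ : Fin n₁ ⊕ Fin n₂ ≃ Fin (n₁ + n₂) := finSumFinEquiv
  have hcomp := (measurePreserving_comp_equiv (d := d) e₀).measurable
  have hm : Measurable fun z : (Fin n₁ ⊕ Fin n₂ → Fin d → ℝ) × (Fin (n₁ + n₂) → Fin d → ℝ) =>
      B' (z.1, z.2 ∘ e₀) :=
    hB'.comp (measurable_fst.prodMk (hcomp.comp measurable_snd))
  refine (lintegral_le_choose_mul i
    (F' := fun x => ∫⁻ y, B' (x, y ∘ e₀) ∂iidCube (Fin (n₁ + n₂)) d)
    hm.lintegral_prod_right' fun x e => ?_).trans ?_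
  · exact lintegral_congr fun y => hB x y e e₀
  · refine mul_le_mul_right (lintegral_mono fun x => ?_) _
    refine lintegral_le_choose_mul i (F := fun y => B' (x, y ∘ e₀)) (F' := fun y => B' (x, y))
      (hB'.comp measurable_prodMk_left) fun y e => ?_
    have h1 := hB (x ∘ e₀.symm) y e₀ e₀
    have h2 := hB (x ∘ e₀.symm) y e₀ e
    have h3 : (x ∘ e₀.symm) ∘ e₀ = x := by funext s; simp
    rw [h3] at h1 h2
    exact h1.symm.trans h2

/-- The reflection x ↦ 1 - x combined with swapping the blocks reduces this to the lower block, with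
n₁ and n₂ interchanged in the Beta law. -/
theorem choose_mul_lintegral_upper_le {n₁ n₂ : ℕ} (h₁ : 1 ≤ n₁) (h₂ : 1 ≤ n₂) (i : Fin d)
    {G : (Fin n₂ → Fin d → ℝ) → ℝ≥0∞} (hG : Measurable G) :
    (n₁ + n₂).choose n₁ * ∫⁻ x in orderedBlocks i (Fin n₁) (Fin n₂), G (x ∘ Sum.inr)
        ∂iidCube (Fin n₁ ⊕ Fin n₂) d ≤
      ∫⁻ t, ∫⁻ u, G (fun j => 1 - axisScale i t * u j) ∂iidCube (Fin n₂) d ∂betaLaw n₂ n₁ := by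
  have hmp : MeasurePreserving (fun (x : Fin n₂ ⊕ Fin n₁ → Fin d → ℝ) (s : Fin n₁ ⊕ Fin n₂) =>
      1 - x s.swap) (iidCube _ d) (iidCube _ d) :=
    measurePreserving_one_sub_iidCube.comp
      (measurePreserving_comp_equiv (Equiv.sumComm (Fin n₁) (Fin n₂)))
  have hset : (fun (x : Fin n₂ ⊕ Fin n₁ → Fin d → ℝ) (s : Fin n₁ ⊕ Fin n₂) => 1 - x s.swap) ⁻¹'
      orderedBlocks i (Fin n₁) (Fin n₂) = orderedBlocks i (Fin n₂) (Fin n₁) := by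
    ext x
    simp only [orderedBlocks, Set.mem_preimage, Set.mem_ofPred_eq, Sum.swap_inl, Sum.swap_inr,
      Pi.sub_apply, Pi.one_apply, sub_le_sub_iff_left]
    exact forall_comm
  have hGr : Measurable fun x : Fin n₁ ⊕ Fin n₂ → Fin d → ℝ => G (x ∘ Sum.inr) :=
    hG.comp (measurable_pi_lambda _ fun j => measurable_pi_apply _)
  rw [← hmp.setLIntegral_comp_preimage (measurableSet_orderedBlocks i _ _) hGr, hset,
    add_comm n₁ n₂, ← Nat.choose_symm_add]
  have hG' : Measurable fun u : Fin n₂ → Fin d → ℝ => G fun j => 1 - u j :=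
    hG.comp (by fun_prop)
  exact choose_mul_lintegral_lower_le h₂ h₁ i hG'

/-- The expected matching cost of two independent blocks of `n₁` uniform points, each rescaled
in the coordinate `i` by an independent Beta distributed factor. -/
noncomputable def blockCost (p : ℝ) (a : Fin d → ℝ) (i : Fin d) (n₁ n₂ : ℕ) : ℝ≥0∞ :=
  ∫⁻ t, ∫⁻ u, ∫⁻ t', ∫⁻ v,
    boxCost p a (fun j => axisScale i t * u j) (fun j => axisScale i t' * v j)
    ∂iidCube (Fin n₁) d ∂betaLaw n₁ n₂ ∂iidCube (Fin n₁) d ∂betaLaw n₁ n₂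

instance (n₁ n₂ : ℕ) : SFinite (betaLaw n₁ n₂) := by unfold betaLaw; infer_instance

theorem measurable_axisScale_mul {Ω : Type*} [MeasurableSpace Ω] {κ : Type*} (i : Fin d) {t : Ω → ℝ}
    {u : Ω → κ → Fin d → ℝ} (ht : Measurable t) (hu : Measurable u) :
    Measurable fun ω j => axisScale i (t ω) * u ω j :=
  measurable_pi_lambda _ fun j =>
    ((measurable_axisScale i).comp ht).mul ((measurable_pi_apply j).comp hu)

/-- X and Y are sorted separately and matched block by block, which can only increase the cost. The
block laws are then inserted for y with x fixed, and afterwards for x. -/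
theorem expCost_le_blockCost {p : ℝ} (hp : 0 ≤ p) (a : Fin d → ℝ) (i : Fin d) {n₁ n₂ : ℕ}
    (h₁ : 1 ≤ n₁) (h₂ : 1 ≤ n₂) :
    expCost (Fin (n₁ + n₂)) p a ≤ blockCost p a i n₁ n₂ + blockCost p a i n₂ n₁ := by
  set C := (((n₁ + n₂).choose n₁ : ℕ) : ℝ≥0∞)
  set A := orderedBlocks i (Fin n₁) (Fin n₂)
  set μ := iidCube (Fin n₁ ⊕ Fin n₂) d
  have hm : Measurable fun z : (Fin n₁ ⊕ Fin n₂ → Fin d → ℝ) × (Fin n₁ ⊕ Fin n₂ → Fin d → ℝ) =>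
      boxCost p a z.1 z.2 := measurable_boxCost p a measurable_fst measurable_snd
  have hl : Measurable fun x : Fin n₁ ⊕ Fin n₂ → Fin d → ℝ => x ∘ Sum.inl :=
    measurable_pi_lambda _ fun j => measurable_pi_apply _
  have hml : Measurable fun z : (Fin n₁ ⊕ Fin n₂ → Fin d → ℝ) × (Fin n₁ ⊕ Fin n₂ → Fin d → ℝ) =>
      boxCost p a (z.1 ∘ Sum.inl) (z.2 ∘ Sum.inl) :=
    measurable_boxCost p a (hl.comp measurable_fst) (hl.comp measurable_snd)
  have step1 : expCost (Fin (n₁ + n₂)) p a ≤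
      C * ∫⁻ x in A, C * ∫⁻ y in A, boxCost p a x y ∂μ ∂μ := by
    exact lintegral_lintegral_le_choose_mul i hm fun x y e e' =>
      (boxCost_comp_equiv p a x y e e').symm
  have hle : C * ∫⁻ x in A, C * ∫⁻ y in A, boxCost p a x y ∂μ ∂μ ≤
      C * (∫⁻ x in A, C * ∫⁻ y in A, boxCost p a (x ∘ Sum.inl) (y ∘ Sum.inl) ∂μ ∂μ) +
      C * ∫⁻ x in A, C * ∫⁻ y in A, boxCost p a (x ∘ Sum.inr) (y ∘ Sum.inr) ∂μ ∂μ := by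
    rw [← mul_add, ← lintegral_add_left (hml.lintegral_prod_right'.const_mul C)]
    refine mul_le_mul_right (lintegral_mono fun x => ?_) _
    simp only
    have hmx : Measurable fun y => boxCost p a (x ∘ Sum.inl) (y ∘ Sum.inl) :=
      measurable_boxCost p a measurable_const hl
    rw [← mul_add, ← lintegral_add_left hmx]
    exact mul_le_mul_right (lintegral_mono fun y => boxCost_sum_le p a x y) _
  refine step1.trans (hle.trans (add_le_add ?_ ?_))
  · set H : (Fin n₁ → Fin d → ℝ) → ℝ≥0∞ := fun u => ∫⁻ t', ∫⁻ v,
      boxCost p a u (fun j => axisScale i t' * v j) ∂iidCube (Fin n₁) d ∂betaLaw n₁ n₂ with hH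
    have hHm : Measurable H := by
      have : Measurable fun z : ((Fin n₁ → Fin d → ℝ) × ℝ) × (Fin n₁ → Fin d → ℝ) =>
          boxCost p a z.1.1 (fun j => axisScale i z.1.2 * z.2 j) :=
        measurable_boxCost p a (by fun_prop) (measurable_axisScale_mul i (by fun_prop) (by fun_prop))
      exact this.lintegral_prod_right'.lintegral_prod_right'
    refine le_trans (mul_le_mul_right (lintegral_mono (g := fun x => H (x ∘ Sum.inl))
      fun x => ?_) _) (choose_mul_lintegral_lower_le h₁ h₂ i hHm)
    exact choose_mul_lintegral_lower_le h₁ h₂ i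
      (measurable_boxCost p a measurable_const measurable_id)
  · set H : (Fin n₂ → Fin d → ℝ) → ℝ≥0∞ := fun u => ∫⁻ t', ∫⁻ v,
      boxCost p a u (fun j => 1 - axisScale i t' * v j) ∂iidCube (Fin n₂) d ∂betaLaw n₂ n₁ with hH
    have hHm : Measurable H := by
      have : Measurable fun z : ((Fin n₂ → Fin d → ℝ) × ℝ) × (Fin n₂ → Fin d → ℝ) =>
          boxCost p a z.1.1 (fun j => 1 - axisScale i z.1.2 * z.2 j) :=
        measurable_boxCost p a (by fun_prop) (measurable_pi_lambda _ fun j =>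
          measurable_const.sub ((measurable_pi_apply j).comp
            (measurable_axisScale_mul i (by fun_prop) (by fun_prop))))
      exact this.lintegral_prod_right'.lintegral_prod_right'
    refine le_trans (mul_le_mul_right (lintegral_mono (g := fun x => H (x ∘ Sum.inr))
      fun x => ?_) _) ((choose_mul_lintegral_upper_le h₁ h₂ i hHm).trans (le_of_eq ?_))
    · exact choose_mul_lintegral_upper_le h₁ h₂ i
        (measurable_boxCost p a measurable_const measurable_id)
    · simp only [hH, boxCost_one_sub hp]
      rfl

theorem edist_axisScale_le {a u : Fin d → ℝ} (ha : ∀ j, 0 ≤ a j)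
    (hu : ∀ j, u j ∈ Set.Icc (0 : ℝ) 1) (i : Fin d) (t q : ℝ) :
    edist (scaleEmb a (axisScale i t * u)) (scaleEmb a (axisScale i q * u)) ≤
      ENNReal.ofReal (a i) * ‖t - q‖ₑ := by
  rw [Real.enorm_eq_ofReal_abs, ← ENNReal.ofReal_mul (ha i), edist_dist, EuclideanSpace.dist_eq]
  refine ENNReal.ofReal_le_ofReal ?_
  rw [Finset.sum_eq_single i]
  · rw [Real.sqrt_sq dist_nonneg]
    simp only [scaleEmb, axisScale, Pi.mul_apply, Function.update_self, Real.dist_eq]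
    rw [← mul_sub, ← sub_mul, abs_mul, abs_mul, abs_of_nonneg (ha i), abs_of_nonneg (hu i).1]
    refine mul_le_mul_of_nonneg_left ?_ (ha i)
    exact mul_le_of_le_one_right (abs_nonneg _) (hu i).2
  · intro j _ hj
    simp [scaleEmb, axisScale, Function.update_of_ne hj]
  · simp

theorem lintegral_fst_prod {α β : Type*} [MeasurableSpace α] [MeasurableSpace β] {μ : Measure α}
    {ν : Measure β} [SFinite μ] [IsProbabilityMeasure ν] {f : α → ℝ≥0∞} (hf : Measurable f) :
    ∫⁻ z, f z.1 ∂μ.prod ν = ∫⁻ x, f x ∂μ := by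
  have h : Measurable fun z : α × β => f z.1 := hf.comp measurable_fst
  rw [lintegral_prod _ h.aemeasurable]
  simp

theorem lintegral_prod_prod {α β : Type*} [MeasurableSpace α] [MeasurableSpace β] {μ : Measure α}
    {ν : Measure β} [SFinite μ] [SFinite ν] {h : (α × β) × (α × β) → ℝ≥0∞} (hh : Measurable h) :
    ∫⁻ z, h z ∂(μ.prod ν).prod (μ.prod ν) =
      ∫⁻ t, ∫⁻ u, ∫⁻ t', ∫⁻ v, h ((t, u), (t', v)) ∂ν ∂μ ∂ν ∂μ := by
  rw [lintegral_prod _ hh.aemeasurable, lintegral_prod _ hh.lintegral_prod_right'.aemeasurable]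
  refine lintegral_congr fun t => lintegral_congr fun u => ?_
  have h' : Measurable fun y => h ((t, u), y) := hh.comp measurable_prodMk_left
  rw [lintegral_prod _ h'.aemeasurable]

/-- Minkowski in L^p of the joint law of both blocks: the first term is the cost with both random
lengths replaced by q, and the factor 2 accounts for moving the X block and the Y block. -/
theorem blockCost_rpow_le {p : ℝ} (hp : 1 ≤ p) {a : Fin d → ℝ} (ha : ∀ j, 0 ≤ a j) (i : Fin d)
    (n₁ : ℕ) {n₂ : ℕ} (h₂ : 1 ≤ n₂) (q : ℝ) :
    blockCost p a i n₁ n₂ ^ (1 / p) ≤ expCost (Fin n₁) p (a * axisScale i q) ^ (1 / p) +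
      2 * ((n₁ : ℝ≥0∞) ^ (1 / p) * ENNReal.ofReal (a i) *
        eLpNorm' (fun t : ℝ => t - q) p (betaLaw n₁ n₂)) := by
  have hp0 : 0 < p := by linarith
  have := isProbabilityMeasure_betaLaw n₁ h₂
  set ρ := (betaLaw n₁ n₂).prod (iidCube (Fin n₁) d) with hρ
  set K : ℝ≥0∞ := (n₁ : ℝ≥0∞) ^ (1 / p) * ENNReal.ofReal (a i) with hK
  have hKtop : K ≠ ∞ :=
    ENNReal.mul_ne_top (ENNReal.rpow_ne_top_of_nonneg (by positivity) (by simp)) (by simp)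
  have hW : Measurable fun z : (ℝ × (Fin n₁ → Fin d → ℝ)) × (ℝ × (Fin n₁ → Fin d → ℝ)) => boxCost p a (fun j => axisScale i z.1.1 * z.1.2 j)
      (fun j => axisScale i z.2.1 * z.2.2 j) :=
    measurable_boxCost p a (measurable_axisScale_mul i (by fun_prop) (by fun_prop))
      (measurable_axisScale_mul i (by fun_prop) (by fun_prop))
  have hV : Measurable fun z : (ℝ × (Fin n₁ → Fin d → ℝ)) × (ℝ × (Fin n₁ → Fin d → ℝ)) => boxCost p (a * axisScale i q) z.1.2 z.2.2 :=
    measurable_boxCost p _ (by fun_prop) (by fun_prop)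
  have hb : blockCost p a i n₁ n₂ = ∫⁻ z : (ℝ × (Fin n₁ → Fin d → ℝ)) × (ℝ × (Fin n₁ → Fin d → ℝ)), boxCost p a
      (fun j => axisScale i z.1.1 * z.1.2 j) (fun j => axisScale i z.2.1 * z.2.2 j) ∂ρ.prod ρ := by
    exact (lintegral_prod_prod hW).symm
  have hc : expCost (Fin n₁) p (a * axisScale i q) =
      ∫⁻ z : (ℝ × (Fin n₁ → Fin d → ℝ)) × (ℝ × (Fin n₁ → Fin d → ℝ)), boxCost p (a * axisScale i q) z.1.2 z.2.2 ∂ρ.prod ρ := by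
    rw [hρ, lintegral_prod_prod hV]
    simp only [lintegral_const, measure_univ, mul_one]
    rfl
  have hmem1 : ∀ᵐ z : (ℝ × (Fin n₁ → Fin d → ℝ)) × (ℝ × (Fin n₁ → Fin d → ℝ)) ∂ρ.prod ρ, ∀ j k, z.1.2 j k ∈ Set.Icc (0 : ℝ) 1 :=
    Measure.quasiMeasurePreserving_fst.ae (Measure.quasiMeasurePreserving_snd.ae ae_iidCube_mem)
  have hmem2 : ∀ᵐ z : (ℝ × (Fin n₁ → Fin d → ℝ)) × (ℝ × (Fin n₁ → Fin d → ℝ)) ∂ρ.prod ρ, ∀ j k, z.2.2 j k ∈ Set.Icc (0 : ℝ) 1 :=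
    Measure.quasiMeasurePreserving_snd.ae (Measure.quasiMeasurePreserving_snd.ae ae_iidCube_mem)
  set f : (ℝ × (Fin n₁ → Fin d → ℝ)) × (ℝ × (Fin n₁ → Fin d → ℝ)) → ℝ≥0∞ := fun z => boxCost p (a * axisScale i q) z.1.2 z.2.2 ^ (1 / p) with hf
  set g₁ : (ℝ × (Fin n₁ → Fin d → ℝ)) × (ℝ × (Fin n₁ → Fin d → ℝ)) → ℝ≥0∞ := fun z => K * ‖z.1.1 - q‖ₑ with hg₁
  set g₂ : (ℝ × (Fin n₁ → Fin d → ℝ)) × (ℝ × (Fin n₁ → Fin d → ℝ)) → ℝ≥0∞ := fun z => K * ‖z.2.1 - q‖ₑ with hg₂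
  have hfm : Measurable f := hV.pow_const _
  have hg₁m : Measurable g₁ := by fun_prop
  have hg₂m : Measurable g₂ := by fun_prop
  have hdisp : ∀ (u : Fin n₁ → Fin d → ℝ) (t : ℝ), (∀ j k, u j k ∈ Set.Icc (0 : ℝ) 1) →
      (∑ j, edist (scaleEmb a (axisScale i t * u j)) (scaleEmb (a * axisScale i q) (u j)) ^ p) ^
        (1 / p) ≤ K * ‖t - q‖ₑ := by
    intro u t hu
    have h1 : ∑ j, edist (scaleEmb a (axisScale i t * u j)) (scaleEmb (a * axisScale i q) (u j)) ^ p
        ≤ n₁ * (ENNReal.ofReal (a i) * ‖t - q‖ₑ) ^ p := by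
      have h0 : ∀ j, edist (scaleEmb a (axisScale i t * u j)) (scaleEmb (a * axisScale i q) (u j)) ≤
          ENNReal.ofReal (a i) * ‖t - q‖ₑ := fun j => by
        rw [← scaleEmb_mul]; exact edist_axisScale_le ha (hu j) i t q
      exact (Finset.sum_le_sum fun j _ => ENNReal.rpow_le_rpow (h0 j) hp0.le).trans
        (le_of_eq (by simp))
    refine (ENNReal.rpow_le_rpow h1 (by positivity)).trans (le_of_eq ?_)
    rw [ENNReal.mul_rpow_of_nonneg _ _ (by positivity), ← ENNReal.rpow_mul,
      mul_one_div_cancel hp0.ne', ENNReal.rpow_one, hK, mul_assoc]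
  have hpt : ∀ᵐ z : (ℝ × (Fin n₁ → Fin d → ℝ)) × (ℝ × (Fin n₁ → Fin d → ℝ)) ∂ρ.prod ρ, boxCost p a (fun j => axisScale i z.1.1 * z.1.2 j)
      (fun j => axisScale i z.2.1 * z.2.2 j) ≤ (f z + (g₁ z + g₂ z)) ^ p := by
    filter_upwards [hmem1, hmem2] with z hz1 hz2
    rw [← ENNReal.rpow_inv_le_iff hp0, ← one_div]
    refine (matchCost_rpow_le hp _ _ (fun j => scaleEmb (a * axisScale i q) (z.1.2 j))
      (fun j => scaleEmb (a * axisScale i q) (z.2.2 j))).trans ?_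
    exact add_le_add le_rfl (add_le_add (hdisp _ _ hz1) (hdisp _ _ hz2))
  have hfp : (∫⁻ z, f z ^ p ∂ρ.prod ρ) = expCost (Fin n₁) p (a * axisScale i q) := by
    rw [hc]
    refine lintegral_congr fun z => ?_
    rw [hf, ← ENNReal.rpow_mul, one_div_mul_cancel hp0.ne', ENNReal.rpow_one]
  have hgp : (∫⁻ t, (K * ‖t - q‖ₑ) ^ p ∂betaLaw n₁ n₂) ^ (1 / p) =
      K * eLpNorm' (fun t : ℝ => t - q) p (betaLaw n₁ n₂) := by
    simp_rw [ENNReal.mul_rpow_of_nonneg _ _ hp0.le]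
    rw [lintegral_const_mul' _ _ (ENNReal.rpow_ne_top_of_nonneg hp0.le hKtop),
      ENNReal.mul_rpow_of_nonneg _ _ (by positivity), ← ENNReal.rpow_mul,
      mul_one_div_cancel hp0.ne', ENNReal.rpow_one]
    rfl
  have hkm : Measurable fun t : ℝ => (K * ‖t - q‖ₑ) ^ p := by fun_prop
  have hg₁p : (∫⁻ z, g₁ z ^ p ∂ρ.prod ρ) = ∫⁻ t, (K * ‖t - q‖ₑ) ^ p ∂betaLaw n₁ n₂ := by
    rw [← lintegral_fst_prod (ν := iidCube (Fin n₁) d) hkm]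
    exact lintegral_fst_prod (f := fun z : (ℝ × (Fin n₁ → Fin d → ℝ)) => (K * ‖z.1 - q‖ₑ) ^ p) (hkm.comp measurable_fst)
  have hg₂p : (∫⁻ z, g₂ z ^ p ∂ρ.prod ρ) = ∫⁻ t, (K * ‖t - q‖ₑ) ^ p ∂betaLaw n₁ n₂ := by
    rw [← hg₁p, ← lintegral_prod_swap]
    rfl
  calc blockCost p a i n₁ n₂ ^ (1 / p)
      ≤ (∫⁻ z, (f + (g₁ + g₂)) z ^ p ∂ρ.prod ρ) ^ (1 / p) := by
        rw [hb]
        exact ENNReal.rpow_le_rpow (lintegral_mono_ae hpt) (by positivity)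
    _ ≤ (∫⁻ z, f z ^ p ∂ρ.prod ρ) ^ (1 / p) + ((∫⁻ z, g₁ z ^ p ∂ρ.prod ρ) ^ (1 / p) +
          (∫⁻ z, g₂ z ^ p ∂ρ.prod ρ) ^ (1 / p)) :=
        (ENNReal.lintegral_Lp_add_le hfm.aemeasurable (hg₁m.add hg₂m).aemeasurable hp).trans
          (add_le_add le_rfl (ENNReal.lintegral_Lp_add_le hg₁m.aemeasurable hg₂m.aemeasurable hp))
    _ = _ := by rw [hfp, hg₁p, hg₂p, hgp, two_mul]

end Split

/-! ### The p-mean distance as a split cost, and its lower bound -/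

section NormCost

variable {d : ℕ}

theorem expCost_ne_top {κ : Type*} [Fintype κ] {p : ℝ} (hp : 0 ≤ p) {a : Fin d → ℝ}
    (ha : ∀ i, 0 ≤ a i) : expCost κ p a ≠ ∞ := by
  refine ne_top_of_le_ne_top ?_ (expCost_le hp ha fun i =>
    Finset.single_le_sum (f := a) (fun j _ => ha j) (Finset.mem_univ i))
  exact ENNReal.mul_ne_top (by simp) (ENNReal.rpow_ne_top_of_nonneg hp ENNReal.ofReal_ne_top)

/-- The expected `p`-mean matching distance of `n` pairs of uniform points in a box. -/
noncomputable def normCost (p : ℝ) (a : Fin d → ℝ) (n : ℕ) : ℝ :=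
  ((expCost (Fin n) p a).toReal / n) ^ (1 / p)

theorem normCost_nonneg (p : ℝ) (a : Fin d → ℝ) (n : ℕ) : 0 ≤ normCost p a n := by
  unfold normCost; positivity

theorem normCost_rpow {p : ℝ} (hp : 0 < p) (a : Fin d → ℝ) (n : ℕ) :
    normCost p a n ^ p = (expCost (Fin n) p a).toReal / n := by
  unfold normCost
  rw [← Real.rpow_mul (by positivity), one_div_mul_cancel hp.ne', Real.rpow_one]

theorem expCost_rpow_eq {p : ℝ} (hp : 0 < p) {a : Fin d → ℝ} (ha : ∀ i, 0 ≤ a i) {n : ℕ}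
    (hn : 1 ≤ n) :
    expCost (Fin n) p a ^ (1 / p) = ENNReal.ofReal ((n : ℝ) ^ (1 / p) * normCost p a n) := by
  have hn0 : (0 : ℝ) < n := by positivity
  unfold normCost
  rw [← Real.mul_rpow hn0.le (by positivity), mul_div_cancel₀ _ hn0.ne',
    ← ENNReal.ofReal_rpow_of_nonneg (by positivity) (by positivity),
    ENNReal.ofReal_toReal (expCost_ne_top hp.le ha)]

theorem mul_axisScale (a : Fin d → ℝ) (i : Fin d) (q : ℝ) :
    a * axisScale i q = Function.update a i (a i * q) := by
  funext j
  rcases eq_or_ne j i with rfl | hj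
  · simp [axisScale]
  · simp [axisScale, Function.update_of_ne hj]

theorem blockCost_le_ofReal {p : ℝ} (hp : 1 ≤ p) {C : ℝ} (hC : 0 ≤ C) {a : Fin d → ℝ}
    (ha : ∀ j, 0 < a j) (i : Fin d) {n₁ n₂ : ℕ} (h₁ : 1 ≤ n₁) (h₂ : 1 ≤ n₂)
    (hbeta : eLpNorm' (fun t : ℝ => t - (n₁ : ℝ) / (n₁ + n₂ : ℕ)) p (betaLaw n₁ n₂) ≤
      ENNReal.ofReal (C * ((n₁ + n₂ : ℕ) : ℝ) ^ (-(1 / 2) : ℝ))) :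
    blockCost p a i n₁ n₂ ≤ ENNReal.ofReal (n₁ *
      (normCost p (Function.update a i (a i * ((n₁ : ℝ) / (n₁ + n₂ : ℕ)))) n₁ +
        2 * C * a i * ((n₁ + n₂ : ℕ) : ℝ) ^ (-(1 / 2) : ℝ)) ^ p) := by
  have hp0 : 0 < p := by linarith
  have hq : (0 : ℝ) < (n₁ : ℝ) / (n₁ + n₂ : ℕ) := by positivity
  set q := (n₁ : ℝ) / (n₁ + n₂ : ℕ)
  set e := ((n₁ + n₂ : ℕ) : ℝ) ^ (-(1 / 2) : ℝ) with he
  have he0 : 0 ≤ e := by positivity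
  set c := normCost p (Function.update a i (a i * q)) n₁ with hc
  have hc0 : 0 ≤ c := normCost_nonneg _ _ _
  have hai := ha i
  have h := blockCost_rpow_le hp (fun j => (ha j).le) i n₁ h₂ q
  rw [mul_axisScale, expCost_rpow_eq hp0 (fun j => (update_pos ha hq j).le) h₁] at h
  have h3 : blockCost p a i n₁ n₂ ^ (1 / p) ≤
      ENNReal.ofReal ((n₁ : ℝ) ^ (1 / p) * (c + 2 * C * a i * e)) := by
    refine h.trans ?_
    calc _ ≤ ENNReal.ofReal ((n₁ : ℝ) ^ (1 / p) * c) + 2 * ((n₁ : ℝ≥0∞) ^ (1 / p) *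
          ENNReal.ofReal (a i) * ENNReal.ofReal (C * e)) := by gcongr
      _ = _ := by
        rw [← ENNReal.ofReal_natCast n₁, ENNReal.ofReal_rpow_of_nonneg (by positivity)
          (by positivity), ← ENNReal.ofReal_mul (by positivity),
          ← ENNReal.ofReal_mul (by positivity), ← ENNReal.ofReal_ofNat,
          ← ENNReal.ofReal_mul (by positivity), ← ENNReal.ofReal_add (by positivity)
          (by positivity)]
        congr 1; ring
  rw [one_div, ENNReal.rpow_inv_le_iff hp0] at h3
  refine h3.trans (le_of_eq ?_)
  rw [ENNReal.ofReal_rpow_of_nonneg (by positivity) hp0.le,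
    Real.mul_rpow (by positivity) (by positivity), ← Real.rpow_mul (by positivity),
    inv_mul_cancel₀ hp0.ne', Real.rpow_one]

theorem exists_isSplitCost_normCost (d : ℕ) {p : ℝ} (hp : 1 ≤ p) :
    ∃ C : ℝ, IsSplitCost p C √d (normCost p : (Fin d → ℝ) → ℕ → ℝ) := by
  have hp0 : 0 < p := by linarith
  obtain ⟨C, hC, hbeta⟩ := exists_eLpNorm'_betaLaw_le hp
  refine ⟨2 * C, hp, by positivity, by positivity, normCost_nonneg p, ?_, ?_, ?_, ?_⟩
  · intro a b n ha hab
    unfold normCost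
    have := ENNReal.toReal_mono (expCost_ne_top hp0.le fun i => (ha i).trans (hab i))
      (expCost_mono (κ := Fin n) hp0.le ha hab)
    gcongr
  · intro t a n ht
    unfold normCost
    rw [expCost_smul hp0.le ht, ENNReal.toReal_mul, ← ENNReal.toReal_rpow,
      ENNReal.toReal_ofReal ht.le, mul_div_assoc, Real.mul_rpow (by positivity) (by positivity),
      ← Real.rpow_mul ht.le, mul_one_div_cancel hp0.ne', Real.rpow_one]
  · intro a n K ha hK
    have hK0 : 0 ≤ √d * K := by
      rcases Nat.eq_zero_or_pos d with rfl | hd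
      · simp
      · exact mul_nonneg (by positivity) ((ha ⟨0, hd⟩).trans (hK _))
    have h1 := ENNReal.toReal_mono (ENNReal.mul_ne_top (by simp)
      (ENNReal.rpow_ne_top_of_nonneg hp0.le ENNReal.ofReal_ne_top)) (expCost_le (κ := Fin n) hp0.le ha hK)
    rw [ENNReal.toReal_mul, ← ENNReal.toReal_rpow, ENNReal.toReal_ofReal hK0] at h1
    simp only [Fintype.card_fin, ENNReal.toReal_natCast] at h1
    rw [← Real.rpow_le_rpow_iff (normCost_nonneg _ _ _) hK0 hp0, normCost_rpow hp0]
    exact div_le_of_le_mul₀ (by positivity) (by positivity) (by linarith)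
  · intro a n₁ n₂ i ha h₁ h₂
    have hn : (0 : ℝ) < (n₁ + n₂ : ℕ) := by positivity
    have b1 := blockCost_le_ofReal hp hC ha i h₁ h₂ (hbeta n₁ n₂ h₁ h₂)
    have b2 := blockCost_le_ofReal hp hC ha i h₂ h₁ (hbeta n₂ n₁ h₂ h₁)
    rw [add_comm n₂ n₁] at b2
    have h := (expCost_le_blockCost hp0.le a i h₁ h₂).trans (add_le_add b1 b2)
    have hai := ha i
    have hnn : ∀ (b : Fin d → ℝ) (k : ℕ), 0 ≤ (k : ℝ) * (normCost p b k +
        2 * C * a i * ((n₁ + n₂ : ℕ) : ℝ) ^ (-(1 / 2) : ℝ)) ^ p := fun b k => by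
      have := normCost_nonneg p b k
      positivity
    rw [← ENNReal.ofReal_add (hnn _ _) (hnn _ _)] at h
    have h' := ENNReal.toReal_mono ENNReal.ofReal_ne_top h
    rw [ENNReal.toReal_ofReal (add_nonneg (hnn _ _) (hnn _ _))] at h'
    rw [normCost_rpow hp0, mul_div_cancel₀ _ hn.ne']
    exact h'

/-- The ball lies in a cube of side 2r. -/
theorem cubeMeasure_near_le (x : Fin d → ℝ) {r : ℝ} (hr : 0 ≤ r) :
    cubeMeasure d {y | edist (scaleEmb 1 x) (scaleEmb 1 y) < ENNReal.ofReal r} ≤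
      ENNReal.ofReal ((2 * r) ^ d) := by
  have hsub : {y : Fin d → ℝ | edist (scaleEmb 1 x) (scaleEmb 1 y) < ENNReal.ofReal r} ⊆
      Set.univ.pi fun i => Set.Ioo (x i - r) (x i + r) := by
    intro y hy i _
    have h1 : edist (scaleEmb 1 x) (scaleEmb 1 y) < ENNReal.ofReal r := hy
    rw [edist_dist] at h1
    have h2 := (ENNReal.ofReal_lt_ofReal_iff_of_nonneg dist_nonneg).1 h1
    have h3 : |x i - y i| ≤ dist (scaleEmb 1 x) (scaleEmb 1 y) := by
      have := PiLp.norm_apply_le (scaleEmb 1 x - scaleEmb 1 y) i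
      rw [← dist_eq_norm] at this
      simpa [scaleEmb] using this
    have h4 := abs_lt.1 (h3.trans_lt h2)
    constructor <;> linarith [h4.1, h4.2]
  refine (measure_mono hsub).trans ?_
  unfold cubeMeasure
  rw [Measure.pi_pi]
  calc _ ≤ ∏ _i : Fin d, ENNReal.ofReal (2 * r) := by
        refine Finset.prod_le_prod' fun i _ => (Measure.restrict_apply_le _ _).trans ?_
        rw [Real.volume_Ioo]
        exact ENNReal.ofReal_le_ofReal (by linarith)
    _ = _ := by rw [ENNReal.ofReal_pow (by positivity)]; simp

/-- For any fixed x, the r-balls around its points have total measure at most 1/2. So each y_k is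
with probability at least 1/2 at distance r or more from all of x, and then costs at least r^p under
every permutation. -/
theorem le_expCost {p : ℝ} (hp : 0 ≤ p) {n : ℕ} {r : ℝ} (hr : 0 ≤ r)
    (hnr : n * (2 * r) ^ d ≤ 1 / 2) :
    n * (ENNReal.ofReal r ^ p * 2⁻¹) ≤ expCost (Fin n) p (1 : Fin d → ℝ) := by
  have key : ∀ x : Fin n → Fin d → ℝ, n * (ENNReal.ofReal r ^ p * 2⁻¹) ≤
      ∫⁻ y, boxCost p 1 x y ∂iidCube (Fin n) d := by
    intro x
    set G : Set (Fin d → ℝ) := {y | ∀ j, ENNReal.ofReal r ≤ edist (scaleEmb 1 (x j)) (scaleEmb 1 y)}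
      with hG
    have hGm : MeasurableSet G := by
      rw [hG]; simp only [Set.ofPred_forall]
      refine .iInter fun j => measurableSet_le measurable_const ?_
      exact measurable_const.edist (measurable_scaleEmb measurable_const measurable_id)
    have hGc : Gᶜ ⊆ ⋃ j, {y | edist (scaleEmb 1 (x j)) (scaleEmb 1 y) < ENNReal.ofReal r} := by
      intro y hy
      simp only [hG, Set.mem_compl_iff, Set.mem_ofPred_eq, not_forall, not_le] at hy
      simpa using hy
    have hGc' : cubeMeasure d Gᶜ ≤ 2⁻¹ := by
      refine (measure_mono hGc).trans ((measure_iUnion_fintype_le _ _).trans ?_)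
      refine (Finset.sum_le_sum fun j _ => cubeMeasure_near_le (x j) hr).trans ?_
      simp only [Finset.sum_const, Finset.card_univ, Fintype.card_fin, nsmul_eq_mul]
      rw [← ENNReal.ofReal_natCast, ← ENNReal.ofReal_mul (by positivity)]
      refine (ENNReal.ofReal_le_ofReal hnr).trans (le_of_eq ?_)
      rw [one_div, ENNReal.ofReal_inv_of_pos (by norm_num)]; simp
    have hGmeas : 2⁻¹ ≤ cubeMeasure d G := by
      have h1 := measure_add_measure_compl (μ := cubeMeasure d) hGm
      rw [measure_univ] at h1
      by_contra hlt
      push Not at hlt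
      have := ENNReal.add_lt_add_of_lt_of_le (ne_top_of_le_ne_top (by simp) hGc') hlt hGc'
      rw [h1, ENNReal.inv_two_add_inv_two] at this
      exact lt_irrefl _ this
    have hlow : ∀ y : Fin n → Fin d → ℝ,
        ∑ k, G.indicator (fun _ => ENNReal.ofReal r ^ p) (y k) ≤ boxCost p 1 x y := by
      intro y
      refine le_iInf fun π => ?_
      rw [← Equiv.sum_comp π]
      refine Finset.sum_le_sum fun j _ => ?_
      by_cases h : y (π j) ∈ G
      · rw [Set.indicator_of_mem h]
        exact ENNReal.rpow_le_rpow (h j) hp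
      · rw [Set.indicator_of_notMem h]; exact zero_le
    refine le_trans ?_ (lintegral_mono hlow)
    have hgm : Measurable (G.indicator fun _ => ENNReal.ofReal r ^ p) :=
      measurable_const.indicator hGm
    have heval : ∀ k : Fin n, ∫⁻ y, G.indicator (fun _ => ENNReal.ofReal r ^ p) (y k)
        ∂iidCube (Fin n) d = ENNReal.ofReal r ^ p * cubeMeasure d G := fun k => by
      rw [← lintegral_indicator_const hGm]
      exact (measurePreserving_eval (fun _ : Fin n => cubeMeasure d) k).lintegral_comp hgm
    have hgk : ∀ k : Fin n, Measurable fun y : Fin n → Fin d → ℝ =>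
        G.indicator (fun _ => ENNReal.ofReal r ^ p) (y k) := fun k =>
      hgm.comp (measurable_pi_apply k)
    rw [lintegral_finsetSum _ fun k _ => hgk k]
    simp_rw [heval]
    simp only [Finset.sum_const, Finset.card_univ, Fintype.card_fin, nsmul_eq_mul]
    gcongr
  calc _ = ∫⁻ _x : Fin n → Fin d → ℝ, n * (ENNReal.ofReal r ^ p * 2⁻¹) ∂iidCube (Fin n) d := by simp
    _ ≤ _ := lintegral_mono key

theorem exists_pos_le_normalized (hd : d ≠ 0) {p : ℝ} (hp : 0 < p) :
    ∃ b : ℝ, 0 < b ∧ ∀ n : ℕ, 1 ≤ n →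
      b ≤ (n : ℝ) ^ (1 / (d : ℝ)) * normCost p (1 : Fin d → ℝ) n := by
  refine ⟨(1 / 2) * (1 / 2 : ℝ) ^ (1 / (d : ℝ)) * (1 / 2 : ℝ) ^ (1 / p), by positivity, fun n hn => ?_⟩
  have hn0 : (0 : ℝ) < n := by positivity
  have hdR : (d : ℝ) ≠ 0 := by exact_mod_cast hd
  -- Chosen so that n·(2r)^d = 1/2.
  set r : ℝ := 1 / 2 * (1 / 2 / n : ℝ) ^ (1 / (d : ℝ)) with hr
  have hr0 : 0 ≤ r := by positivity
  have hnr : n * (2 * r) ^ d ≤ 1 / 2 := by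
    have : 2 * r = (1 / 2 / n : ℝ) ^ (1 / (d : ℝ)) := by rw [hr]; ring
    rw [this, ← Real.rpow_natCast, ← Real.rpow_mul (by positivity), one_div_mul_cancel hdR,
      Real.rpow_one]
    field_simp; exact le_rfl
  have h := ENNReal.toReal_mono (expCost_ne_top (a := 1) hp.le fun _ => zero_le_one)
    (le_expCost (d := d) hp.le hr0 hnr)
  rw [ENNReal.toReal_mul, ENNReal.toReal_mul, ← ENNReal.toReal_rpow, ENNReal.toReal_ofReal hr0]
    at h
  simp only [ENNReal.toReal_natCast, ENNReal.toReal_inv, ENNReal.toReal_ofNat] at h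
  have h2 : r * (1 / 2 : ℝ) ^ (1 / p) ≤ normCost p (1 : Fin d → ℝ) n := by
    unfold normCost
    have e : r * (1 / 2 : ℝ) ^ (1 / p) = (r ^ p * (1 / 2)) ^ (1 / p) := by
      rw [Real.mul_rpow (by positivity) (by positivity), ← Real.rpow_mul hr0,
        mul_one_div_cancel hp.ne', Real.rpow_one]
    rw [e]
    refine Real.rpow_le_rpow (by positivity) ?_ (by positivity)
    rw [le_div_iff₀ hn0, one_div]
    linarith
  calc _ = (n : ℝ) ^ (1 / (d : ℝ)) * (r * (1 / 2 : ℝ) ^ (1 / p)) := by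
        rw [hr, Real.div_rpow (by positivity) hn0.le]
        field_simp
    _ ≤ _ := by gcongr

end NormCost

/-! ### Transfer to the given random variables -/

section Law

variable {d : ℕ}

theorem minMatchingCost_eq_toReal {n : ℕ} {p : ℝ} (hp : 0 ≤ p)
    (x y : Fin n → EuclideanSpace ℝ (Fin d)) :
    minMatchingCost p x y = (matchCost p x y).toReal := by
  have hsum : ∀ π : Equiv.Perm (Fin n), ∑ j, edist (x j) (y (π j)) ^ p =
      ENNReal.ofReal (∑ j, ‖x j - y (π j)‖ ^ p) := fun π => by
    rw [ENNReal.ofReal_sum_of_nonneg fun j _ => by positivity]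
    refine Finset.sum_congr rfl fun j _ => ?_
    rw [edist_dist, dist_eq_norm, ENNReal.ofReal_rpow_of_nonneg (norm_nonneg _) hp]
  have h0 : 0 ≤ minMatchingCost p x y :=
    Finset.le_inf' _ _ fun π _ => Finset.sum_nonneg fun j _ => by positivity
  have h : matchCost p x y = ENNReal.ofReal (minMatchingCost p x y) := by
    refine le_antisymm ?_ (le_iInf fun π => ?_)
    · obtain ⟨π, -, hπ⟩ := Finset.exists_mem_eq_inf' Finset.univ_nonempty
        fun π : Equiv.Perm (Fin n) => ∑ i, ‖x i - y (π i)‖ ^ p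
      have : minMatchingCost p x y = ∑ i, ‖x i - y (π i)‖ ^ p := hπ
      rw [this, ← hsum]
      exact matchCost_le p x y π
    · rw [hsum]
      exact ENNReal.ofReal_le_ofReal (Finset.inf'_le _ (Finset.mem_univ π))
  rw [h, ENNReal.toReal_ofReal h0]

theorem measurePreserving_toLp_cubeMeasure :
    MeasurePreserving (WithLp.toLp 2) (cubeMeasure d)
      ((volume : Measure (EuclideanSpace ℝ (Fin d))).restrict (unitCube d)) := by
  have hm : MeasurableSet (unitCube d) := by
    unfold unitCube
    simp only [Set.ofPred_forall]
    exact .iInter fun i => measurableSet_Icc.preimage (by fun_prop)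
  have h := (PiLp.volume_preserving_toLp (Fin d)).restrict_preimage hm
  have e : cubeMeasure d = volume.restrict (WithLp.toLp 2 ⁻¹' unitCube d) := by
    unfold cubeMeasure
    rw [← Measure.restrict_pi_pi, volume_pi]
    congr 1
    ext x
    simp only [Set.mem_preimage, unitCube, Set.mem_ofPred_eq, Set.mem_univ_pi]
  rw [e]; exact h

theorem map_eq_of_isUniform {Ω : Type*} [MeasurableSpace Ω] {P : Measure Ω}
    {Z : Ω → EuclideanSpace ℝ (Fin d)} (hZ : pdf.IsUniform Z (unitCube d) P volume) :
    AEMeasurable Z P ∧ P.map Z = (cubeMeasure d).map (WithLp.toLp 2) := by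
  have hmp := measurePreserving_toLp_cubeMeasure (d := d)
  have hvol : (volume : Measure (EuclideanSpace ℝ (Fin d))) (unitCube d) = 1 := by
    rw [← Measure.restrict_apply_univ, ← hmp.map_eq,
      Measure.map_apply hmp.measurable MeasurableSet.univ]
    simp
  refine ⟨hZ.aemeasurable (by simp [hvol]) (by simp [hvol]), ?_⟩
  rw [hmp.map_eq, show P.map Z = _ from hZ, ProbabilityTheory.cond, hvol]
  simp

theorem map_family_eq {Ω : Type*} [MeasurableSpace Ω] {P : Measure Ω} [IsProbabilityMeasure P]
    {X : ℕ → Ω → EuclideanSpace ℝ (Fin d)} (hX : ∀ i, pdf.IsUniform (X i) (unitCube d) P volume)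
    (hind : iIndepFun X P) (n : ℕ) :
    P.map (fun ω (i : Fin n) => X i ω) =
      (iidCube (Fin n) d).map fun x j => WithLp.toLp 2 (x j) := by
  have hm : Measurable (WithLp.toLp 2 : (Fin d → ℝ) → EuclideanSpace ℝ (Fin d)) :=
    measurePreserving_toLp_cubeMeasure.measurable
  have := Measure.isProbabilityMeasure_map (μ := cubeMeasure d) hm.aemeasurable
  have h1 : iIndepFun (fun i : Fin n => X i) P := hind.precomp Fin.val_injective
  rw [(iIndepFun_iff_map_fun_eq_pi_map fun i : Fin n => (map_eq_of_isUniform (hX i)).1).1 h1]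
  simp_rw [fun i => (map_eq_of_isUniform (hX i)).2]
  exact (Measure.pi_map_pi fun _ => hm.aemeasurable).symm

/-- Independence within and between the families makes the joint law the product model, so the
expectation, and with it the limit, does not depend on the probability space. -/
theorem lintegral_matchCost_eq {Ω : Type*} [MeasurableSpace Ω] {P : Measure Ω}
    [IsProbabilityMeasure P] {X Y : ℕ → Ω → EuclideanSpace ℝ (Fin d)}
    (hX : ∀ i, pdf.IsUniform (X i) (unitCube d) P volume)
    (hY : ∀ i, pdf.IsUniform (Y i) (unitCube d) P volume)
    (hXi : iIndepFun X P) (hYi : iIndepFun Y P)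
    (hXY : IndepFun (fun ω i => X i ω) (fun ω i => Y i ω) P) (p : ℝ) (n : ℕ) :
    AEMeasurable (fun ω => matchCost p (fun i : Fin n => X i ω) fun i : Fin n => Y i ω) P ∧
    ∫⁻ ω, matchCost p (fun i : Fin n => X i ω) (fun i : Fin n => Y i ω) ∂P =
      expCost (Fin n) p (1 : Fin d → ℝ) := by
  have hXm : AEMeasurable (fun ω (i : Fin n) => X i ω) P :=
    aemeasurable_pi_lambda _ fun i => (map_eq_of_isUniform (hX i)).1
  have hYm : AEMeasurable (fun ω (i : Fin n) => Y i ω) P :=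
    aemeasurable_pi_lambda _ fun i => (map_eq_of_isUniform (hY i)).1
  have hres : Measurable fun (f : ℕ → EuclideanSpace ℝ (Fin d)) (i : Fin n) => f i := by fun_prop
  have hind : IndepFun (fun ω (i : Fin n) => X i ω) (fun ω (i : Fin n) => Y i ω) P :=
    hXY.comp hres hres
  have hmc : Measurable fun z : (Fin n → EuclideanSpace ℝ (Fin d)) ×
      (Fin n → EuclideanSpace ℝ (Fin d)) => matchCost p z.1 z.2 :=
    measurable_matchCost p (by fun_prop) (by fun_prop)
  have hm : Measurable fun (x : Fin n → Fin d → ℝ) j =>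
      (WithLp.toLp 2 (x j) : EuclideanSpace ℝ (Fin d)) :=
    measurable_pi_lambda _ fun j =>
      measurePreserving_toLp_cubeMeasure.measurable.comp (measurable_pi_apply j)
  have hae := hmc.comp_aemeasurable (hXm.prodMk hYm)
  refine ⟨hae, ?_⟩
  have h1 : ∫⁻ ω, matchCost p (fun i : Fin n => X i ω) (fun i : Fin n => Y i ω) ∂P =
      ∫⁻ z, matchCost p z.1 z.2
        ∂P.map fun ω => ((fun i : Fin n => X i ω), fun i : Fin n => Y i ω) :=
    (lintegral_map' hmc.aemeasurable (hXm.prodMk hYm)).symm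
  rw [h1, (indepFun_iff_map_prod_eq_prod_map_map hXm hYm).1 hind, map_family_eq hX hXi,
    map_family_eq hY hYi, lintegral_prod _ hmc.aemeasurable]
  have hint : Measurable fun x : Fin n → EuclideanSpace ℝ (Fin d) => ∫⁻ y, matchCost p x y
      ∂(iidCube (Fin n) d).map fun x j => WithLp.toLp 2 (x j) := hmc.lintegral_prod_right'
  rw [lintegral_map hint hm]
  unfold expCost
  refine lintegral_congr fun x => ?_
  have hmx : Measurable fun y : Fin n → EuclideanSpace ℝ (Fin d) =>
      matchCost p (fun j => WithLp.toLp 2 (x j)) y :=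
    measurable_matchCost p (fun _ => measurable_const) (by fun_prop)
  rw [lintegral_map hmx hm]
  refine lintegral_congr fun y => ?_
  simp only [boxCost, scaleEmb, one_mul]

end Law

theorem theorem1p1 (d : ℕ) (hd : 3 ≤ d) (p : ℝ) (hp : 1 ≤ p) :
    ∃ fbi : ℝ, 0 < fbi ∧
      ∀ (Ω : Type*) [MeasurableSpace Ω] (P : Measure Ω) [IsProbabilityMeasure P]
        (X Y : ℕ → Ω → EuclideanSpace ℝ (Fin d)),
        (∀ i, pdf.IsUniform (X i) (unitCube d) P volume) →
        (∀ i, pdf.IsUniform (Y i) (unitCube d) P volume) →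
        iIndepFun X P → iIndepFun Y P →
        IndepFun (fun ω i => X i ω) (fun ω i => Y i ω) P →
        (∀ n : ℕ, Integrable (fun ω =>
          (1 / (n : ℝ)) * minMatchingCost p (fun i : Fin n => X i ω) (fun i : Fin n => Y i ω)) P) ∧
        Tendsto (fun n : ℕ => (n : ℝ) ^ (p / (d : ℝ)) *
            ∫ ω, (1 / (n : ℝ)) *
              minMatchingCost p (fun i : Fin n => X i ω) (fun i : Fin n => Y i ω) ∂P)
          atTop (𝓝 fbi) := by
  have hp0 : 0 < p := by linarith
  obtain ⟨C, hC⟩ := exists_isSplitCost_normCost d hp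
  obtain ⟨L, hL⟩ := hC.exists_tendsto hd
  obtain ⟨b, hb, hbn⟩ := exists_pos_le_normalized (d := d) (by omega) hp0
  have hLpos : 0 < L := lt_of_lt_of_le hb
    (ge_of_tendsto hL (by filter_upwards [eventually_ge_atTop 1] with n hn using hbn n hn))
  refine ⟨L ^ p, by positivity, fun Ω _ P _ X Y hX hY hXi hYi hXY => ?_⟩
  have key := fun n => lintegral_matchCost_eq hX hY hXi hYi hXY p n
  have hfin : ∀ n, expCost (Fin n) p (1 : Fin d → ℝ) ≠ ∞ := fun n =>
    expCost_ne_top (a := 1) hp0.le fun _ => zero_le_one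
  simp_rw [minMatchingCost_eq_toReal hp0.le]
  refine ⟨fun n => (integrable_toReal_of_lintegral_ne_top (key n).1
    (by rw [(key n).2]; exact hfin n)).const_mul _, ?_⟩
  -- The p-th power of n^(1/d)·`normCost` is n^(p/d) times the expected mean cost, so the constant
  -- is L^p.
  refine (hL.rpow_const (p := p) (.inr hp0.le)).congr fun n => ?_
  rw [integral_const_mul, integral_toReal (key n).1
    (ae_lt_top' (key n).1 (by rw [(key n).2]; exact hfin n)), (key n).2,
    Real.mul_rpow (by positivity) (normCost_nonneg _ _ _), normCost_rpow hp0,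
    ← Real.rpow_mul (Nat.cast_nonneg n)]
  ring_nf
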